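/- Let $M$ be a compact oriented Riemannian manifold without boundary, of dimension $m\ge 4$, with volume form $\nu_M$, and let $E$ be a smooth Hermitian vector bundle over $M$. For a connection $A$ on $E$ with curvature $F_A$, the Chern character $ch(E)$ is represented by the closed form $\mathrm{Tr}\exp\left(\frac{i}{2\pi}F_A\right)$. Let $\Phi$ be a smooth closed $(m-4)$-form on $M$ (for instance a Yang–Mills calibrating form, i.e. a closed form which in addition satisfies the pointwise bound $\phi\wedge\phi\wedge\Phi\le|\phi|^2\nu_M$ for all $2$-forms $\phi$; this bound is not needed). A Hermitian connection $D$ on $E$ with curvature $F_D$ is called $\Phi$-calibrated if $$\mathrm{Tr}(F_D\wedge F_D)\wedge\Phi=|F_D|^2\,\nu_M\quad\text{at every point of }M,$$ where $|F_D|^2=\sum_{i<j}\mathrm{Tr}\left(F_D(e_i,e_j)^*F_D(e_i,e_j)\right)$ for an orthonormal frame $(e_i)$ of $TM$. **Proposition.** If $E$ admits a $\Phi$-calibrated connection $D$, then $$\int_M ch(E)\,\Phi\le 0,$$ where $ch(E)$ may be computed from any (complex linear) connection on $E$; in particular the left-hand side is real. Equality holds if and only if $E$ is flat, i.e. admits a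 flat Hermitian connection, and also if and only if the calibrated connection $D$ is itself flat. -/

import Mathlib

open scoped Manifold ContDiff Topology
open Bundle

set_option linter.unusedSectionVars false

noncomputable section

/-! ## Differential forms on a manifold -/

/-- The wedge product (normalised as
`(α ∧ β)(v₁, …) = 1 / (k! l!) ∑ σ, sign σ · μ (α (v_σ(1), …)) (β (v_σ(k+1), …))`)
of a `k`-form and an `l`-form on a vector space `T`, with the values multiplied by the
bilinear product `μ`. -/
def wedge {T A B : Type*} (μ : A → B → ℂ) {k l : ℕ} (α : (Fin k → T) → A)
    (β : (Fin l → T) → B) : (Fin (k + l) → T) → ℂ := fun v =>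
  (((k.factorial * l.factorial : ℕ) : ℂ))⁻¹ * ∑ σ : Equiv.Perm (Fin (k + l)),
    ((Equiv.Perm.sign σ : ℤ) : ℂ) *
      μ (α fun i => v (σ (Fin.castAdd l i))) (β fun j => v (σ (Fin.natAdd k j)))

section Forms

variable {m : ℕ} {M : Type*} [TopologicalSpace M] [ChartedSpace (EuclideanSpace ℝ (Fin m)) M]

/-- The pullback of a `k`-form on `M` to the target of the chart around `c`. -/
def formInChart {k : ℕ} (Φ : ∀ x : M, TangentSpace (𝓡 m) x [⋀^Fin k]→L[ℝ] ℝ) (c : M)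
    (z : EuclideanSpace ℝ (Fin m)) : EuclideanSpace ℝ (Fin m) [⋀^Fin k]→L[ℝ] ℝ :=
  (Φ ((extChartAt (𝓡 m) c).symm z)).compContinuousLinearMap
    (mfderiv 𝓘(ℝ, EuclideanSpace ℝ (Fin m)) (𝓡 m) (extChartAt (𝓡 m) c).symm z)

/-- A `k`-form is smooth if it is smooth in the charts. -/
def IsSmoothForm {k : ℕ} (Φ : ∀ x : M, TangentSpace (𝓡 m) x [⋀^Fin k]→L[ℝ] ℝ) : Prop :=
  ∀ c : M, ContDiffOn ℝ ∞ (formInChart Φ c) (extChartAt (𝓡 m) c).target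

/-- A `k`-form is closed, `dΦ = 0`, if its exterior derivative vanishes in the charts. -/
def IsClosedForm {k : ℕ} (Φ : ∀ x : M, TangentSpace (𝓡 m) x [⋀^Fin k]→L[ℝ] ℝ) : Prop :=
  ∀ c : M, ∀ z ∈ (extChartAt (𝓡 m) c).target, extDeriv (formInChart Φ c) z = 0

/-- The coordinate frame `∂₁, …, ∂ₘ` of the chart around `c`, at the point with coordinates `z`. -/
def coordFrame (c : M) (z : EuclideanSpace ℝ (Fin m)) (i : Fin m) :
    TangentSpace (𝓡 m) ((extChartAt (𝓡 m) c).symm z) :=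
  mfderiv 𝓘(ℝ, EuclideanSpace ℝ (Fin m)) (𝓡 m) (extChartAt (𝓡 m) c).symm z
    (EuclideanSpace.single i (1 : ℝ) : EuclideanSpace ℝ (Fin m))

instance tangentFinrankFact (x : M) : Fact (Module.finrank ℝ (TangentSpace (𝓡 m) x) = m) :=
  ⟨finrank_euclideanSpace_fin⟩

instance tangentFiniteDimensional (x : M) : FiniteDimensional ℝ (TangentSpace (𝓡 m) x) :=
  inferInstanceAs (FiniteDimensional ℝ (EuclideanSpace ℝ (Fin m)))

variable [RiemannianBundle (fun x : M => TangentSpace (𝓡 m) x)]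

variable (m M) in
/-- An orientation of a Riemannian manifold: a choice of an orientation of every tangent space
which is coherent, i.e. for which the Riemannian volume form depends continuously on the point. -/
structure ManifoldOrientation where
  /-- The orientation of the tangent space at `x`. -/
  orient : ∀ x : M, Orientation ℝ (TangentSpace (𝓡 m) x) (Fin m)
  coherent : ∀ c : M, ContinuousOn
    (fun z => (orient ((extChartAt (𝓡 m) c).symm z)).volumeForm (coordFrame c z))
    (extChartAt (𝓡 m) c).target

/-- The Riemannian volume form `ν_M` at the point `x`. -/
def ManifoldOrientation.volForm (o : ManifoldOrientation m M) (x : M) :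
    TangentSpace (𝓡 m) x [⋀^Fin m]→ₗ[ℝ] ℝ :=
  (o.orient x).volumeForm

variable [IsManifold (𝓡 m) ∞ M] [T2Space M] [CompactSpace M]

variable (m M) in
/-- A smooth partition of unity subordinate to the domains of the charts. -/
def chartPartition : SmoothPartitionOfUnity M (𝓡 m) M :=
  (SmoothPartitionOfUnity.exists_isSubordinate_chartAt_source (𝓡 m) M).choose

/-- The integral over the compact oriented manifold `M` of a (complex valued) top degree form:
`∑ c, ∫ ρ_c(z) η(∂₁, …, ∂ₘ) dz` for a partition of unity `ρ_c` subordinate to the charts, where a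
chart counts with the sign `+1` or `-1` according to whether or not it is oriented at `z`. -/
def integralForm (o : ManifoldOrientation m M)
    (η : ∀ x : M, (Fin m → TangentSpace (𝓡 m) x) → ℂ) : ℂ :=
  ∑ᶠ c : M, ∫ z in (extChartAt (𝓡 m) c).target,
    ((chartPartition m M c ((extChartAt (𝓡 m) c).symm z) *
      (SignType.sign (o.volForm ((extChartAt (𝓡 m) c).symm z) (coordFrame c z)) : ℝ) : ℝ) : ℂ) *
      η ((extChartAt (𝓡 m) c).symm z) (coordFrame c z)

end Forms

/-! ## Hermitian vector bundles and their connections -/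

section Bundles

variable {m : ℕ} {M : Type*} [TopologicalSpace M] [ChartedSpace (EuclideanSpace ℝ (Fin m)) M]
  [IsManifold (𝓡 m) ∞ M]
  {F : Type*} [NormedAddCommGroup F] [NormedSpace ℂ F]
  {E : M → Type*} [TopologicalSpace (TotalSpace F E)]
  [∀ x, NormedAddCommGroup (E x)] [∀ x, InnerProductSpace ℂ (E x)]
  [FiberBundle F E] [VectorBundle ℂ F E] [VectorBundle ℝ F E]

variable (m F E) in
/-- The Hermitian inner products on the fibres of a complex vector bundle depend smoothly on the
point: in a trivialization, inner products of constant sections are smooth functions. -/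
class IsSmoothHermitianBundle : Prop where
  contMDiffOn_inner : ∀ (e : Trivialization F (TotalSpace.proj : TotalSpace F E → M))
    [MemTrivializationAtlas e] (a b : F),
    ContMDiffOn (𝓡 m) 𝓘(ℝ, ℂ) ∞ (fun x => inner ℂ (e.symm x a) (e.symm x b)) e.baseSet

variable (m F E) in
/-- A smooth connection on the complex vector bundle `E` over the real manifold `M`: a smooth
covariant derivative which is complex linear. (`D σ x v` is the derivative of the section `σ` at
the point `x` in the direction `v`.) -/
structure ComplexConnection extends CovariantDerivative (𝓡 m) F E where
  smooth : ContMDiffCovariantDerivativeOn F ∞ toFun Set.univ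
  smul_section : ∀ (a : ℂ) {σ : ∀ x, E x} {x : M},
    MDifferentiableAt (𝓡 m) ((𝓡 m).prod 𝓘(ℝ, F)) (fun y => TotalSpace.mk' F y (σ y)) x →
    ∀ v : TangentSpace (𝓡 m) x, toFun (fun y => a • σ y) x v = a • toFun σ x v

namespace ComplexConnection

/-- A connection is Hermitian if `d⟨σ, τ⟩ = ⟨D σ, τ⟩ + ⟨σ, D τ⟩`. -/
def IsHermitian (D : ComplexConnection m F E) : Prop :=
  ∀ (σ τ : ∀ x, E x) (x : M),
    MDifferentiableAt (𝓡 m) ((𝓡 m).prod 𝓘(ℝ, F)) (fun y => TotalSpace.mk' F y (σ y)) x →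
    MDifferentiableAt (𝓡 m) ((𝓡 m).prod 𝓘(ℝ, F)) (fun y => TotalSpace.mk' F y (τ y)) x →
    ∀ v : TangentSpace (𝓡 m) x,
      mvfderiv (𝓡 m) (fun y => inner ℂ (σ y) (τ y)) x v =
        inner ℂ (D.toFun σ x v) (τ x) + inner ℂ (σ x) (D.toFun τ x v)

/-- The curvature expression `D_X D_Y σ - D_Y D_X σ - D_[X, Y] σ` at the point `x`. -/
def curvatureExpr (D : ComplexConnection m F E) (X Y : ∀ x : M, TangentSpace (𝓡 m) x)
    (σ : ∀ x, E x) (x : M) : E x :=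
  D.toFun (fun y => D.toFun σ y (Y y)) x (X x) - D.toFun (fun y => D.toFun σ y (X y)) x (Y x)
    - D.toFun σ x (VectorField.mlieBracket (𝓡 m) X Y x)

lemma extend_add {x : M} (s t : E x) : ∀ᶠ y in 𝓝 x,
    FiberBundle.extend F (s + t) y = FiberBundle.extend F s y + FiberBundle.extend F t y := by
  have hx := FiberBundle.mem_baseSet_trivializationAt' (F := F) (E := E) x
  filter_upwards [(trivializationAt F E x).open_baseSet.mem_nhds hx] with y hy
  have h1 := ((trivializationAt F E x).linear ℂ hx).map_add s t
  have h2 := ((trivializationAt F E x).symmₗ ℂ y).map_add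
  rw [Trivialization.coe_symmₗ _ hy] at h2
  simp only [FiberBundle.extend]
  rw [← h2, h1]

lemma extend_smul {x : M} (a : ℂ) (s : E x) : ∀ᶠ y in 𝓝 x,
    FiberBundle.extend F (a • s) y = a • FiberBundle.extend F s y := by
  have hx := FiberBundle.mem_baseSet_trivializationAt' (F := F) (E := E) x
  filter_upwards [(trivializationAt F E x).open_baseSet.mem_nhds hx] with y hy
  have h1 := ((trivializationAt F E x).linear ℂ hx).map_smul a s
  have h2 := ((trivializationAt F E x).symmₗ ℂ y).map_smul a
  rw [Trivialization.coe_symmₗ _ hy] at h2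
  simp only [FiberBundle.extend]
  rw [← h2, h1]

variable [T2Space M]

/-- If `σ` is smooth near `x` and `Y` is differentiable at `x`, then `D_Y σ` is differentiable. -/
lemma mdifferentiableAt_apply (D : ComplexConnection m F E) {σ : ∀ x, E x} {x : M} {s : Set M}
    (hs : s ∈ 𝓝 x)
    (hσ : ContMDiffOn (𝓡 m) ((𝓡 m).prod 𝓘(ℝ, F)) ∞ (fun y => TotalSpace.mk' F y (σ y)) s)
    {Y : ∀ x : M, TangentSpace (𝓡 m) x} (hY : ContMDiffAt (𝓡 m)
      ((𝓡 m).prod 𝓘(ℝ, EuclideanSpace ℝ (Fin m))) 1 (T% Y) x) :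
    MDifferentiableAt (𝓡 m) ((𝓡 m).prod 𝓘(ℝ, F))
      (fun y => TotalSpace.mk' F y (D.toFun σ y (Y y))) x := by
  obtain ⟨u, hus, huo, hxu⟩ := mem_nhds_iff.1 hs
  obtain ⟨f, -, hf⟩ := (SmoothBumpFunction.nhds_basis_tsupport (I := 𝓡 m) x).mem_iff.1
    (huo.mem_nhds hxu)
  have h1 := ContMDiffOn.smul_section_of_tsupport (n := ∞) (f.contMDiff.contMDiffOn (s := u))
    huo hf (hσ.mono hus)
  have h2 := (D.smooth.contMDiff (σ := (f : M → ℝ) • σ) (by simpa using h1.contMDiffOn))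
  have h3 := ((h2.contMDiffAt Filter.univ_mem).of_le (m := 1) (by norm_cast)
    ).clm_bundle_apply hY
  have h4 := h3.mdifferentiableAt one_ne_zero
  refine h4.congr_of_eventuallyEq ?_
  filter_upwards [f.eventuallyEq_one.eventuallyEq_nhds, huo.mem_nhds hxu] with y hy hyu
  have h5 : MDifferentiableAt (𝓡 m) ((𝓡 m).prod 𝓘(ℝ, F)) (fun y => TotalSpace.mk' F y (σ y)) y :=
    ((hσ.mono hus).contMDiffAt (huo.mem_nhds hyu)).mdifferentiableAt (by simp)
  have h6 := D.isCovariantDerivativeOnUniv.congr_of_eventuallyEq (σ' := (f : M → ℝ) • σ) h5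
    (h1.mdifferentiableAt (by simp)) Filter.univ_mem
    (hy.mono fun z hz => by simp [hz])
  rw [h6]

lemma curvatureExpr_add (D : ComplexConnection m F E) {x : M} {a b c : Set M}
    {X Y : ∀ x : M, TangentSpace (𝓡 m) x} {σ τ ρ : ∀ x, E x}
    (hX : ContMDiffAt (𝓡 m) ((𝓡 m).prod 𝓘(ℝ, EuclideanSpace ℝ (Fin m))) 1 (T% X) x)
    (hY : ContMDiffAt (𝓡 m) ((𝓡 m).prod 𝓘(ℝ, EuclideanSpace ℝ (Fin m))) 1 (T% Y) x)
    (ha : a ∈ 𝓝 x)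
    (hσ : ContMDiffOn (𝓡 m) ((𝓡 m).prod 𝓘(ℝ, F)) ∞ (fun y => TotalSpace.mk' F y (σ y)) a)
    (hb : b ∈ 𝓝 x)
    (hτ : ContMDiffOn (𝓡 m) ((𝓡 m).prod 𝓘(ℝ, F)) ∞ (fun y => TotalSpace.mk' F y (τ y)) b)
    (hc : c ∈ 𝓝 x)
    (hρ : ContMDiffOn (𝓡 m) ((𝓡 m).prod 𝓘(ℝ, F)) ∞ (fun y => TotalSpace.mk' F y (ρ y)) c)
    (h : ∀ᶠ y in 𝓝 x, ρ y = σ y + τ y) :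
    D.curvatureExpr X Y ρ x = D.curvatureExpr X Y σ x + D.curvatureExpr X Y τ x := by
  have key0 : ∀ᶠ y in 𝓝 x, D.toFun ρ y = D.toFun σ y + D.toFun τ y := by
    filter_upwards [eventually_mem_nhds_iff.2 ha, eventually_mem_nhds_iff.2 hb,
      eventually_mem_nhds_iff.2 hc, h.eventually_nhds] with y hya hyb hyc hy
    have h1 := (hσ.contMDiffAt hya).mdifferentiableAt (by simp)
    have h2 := (hτ.contMDiffAt hyb).mdifferentiableAt (by simp)
    have h3 := (hρ.contMDiffAt hyc).mdifferentiableAt (by simp)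
    rw [← D.isCovariantDerivativeOnUniv.add h1 h2]
    exact D.isCovariantDerivativeOnUniv.congr_of_eventuallyEq h3
      (mdifferentiableAt_add_section h1 h2) Filter.univ_mem hy
  have key : ∀ Z : ∀ x : M, TangentSpace (𝓡 m) x,
      ContMDiffAt (𝓡 m) ((𝓡 m).prod 𝓘(ℝ, EuclideanSpace ℝ (Fin m))) 1 (T% Z) x →
      D.toFun (fun y => D.toFun ρ y (Z y)) x =
      D.toFun (fun y => D.toFun σ y (Z y)) x + D.toFun (fun y => D.toFun τ y (Z y)) x := by
    intro Z hZ
    have hS := D.mdifferentiableAt_apply ha hσ hZ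
    have hT := D.mdifferentiableAt_apply hb hτ hZ
    have hR := D.mdifferentiableAt_apply hc hρ hZ
    rw [← D.isCovariantDerivativeOnUniv.add hS hT]
    refine D.isCovariantDerivativeOnUniv.congr_of_eventuallyEq hR
      (mdifferentiableAt_add_section hS hT) Filter.univ_mem ?_
    filter_upwards [key0] with y hy
    rw [hy]
    rfl
  simp only [curvatureExpr, key X hX, key Y hY, key0.self_of_nhds, add_apply]
  abel

lemma curvatureExpr_smul (D : ComplexConnection m F E) {x : M} {a c : Set M}
    {X Y : ∀ x : M, TangentSpace (𝓡 m) x} (z : ℂ) {σ ρ : ∀ x, E x}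
    (hX : ContMDiffAt (𝓡 m) ((𝓡 m).prod 𝓘(ℝ, EuclideanSpace ℝ (Fin m))) 1 (T% X) x)
    (hY : ContMDiffAt (𝓡 m) ((𝓡 m).prod 𝓘(ℝ, EuclideanSpace ℝ (Fin m))) 1 (T% Y) x)
    (ha : a ∈ 𝓝 x)
    (hσ : ContMDiffOn (𝓡 m) ((𝓡 m).prod 𝓘(ℝ, F)) ∞ (fun y => TotalSpace.mk' F y (σ y)) a)
    (hc : c ∈ 𝓝 x)
    (hρ : ContMDiffOn (𝓡 m) ((𝓡 m).prod 𝓘(ℝ, F)) ∞ (fun y => TotalSpace.mk' F y (ρ y)) c)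
    (h : ∀ᶠ y in 𝓝 x, ρ y = z • σ y) :
    D.curvatureExpr X Y ρ x = z • D.curvatureExpr X Y σ x := by
  -- near a point where `f` and `z • g` agree and are differentiable, so do their derivatives
  have aux : ∀ (f g : ∀ x, E x) (y : M),
      MDifferentiableAt (𝓡 m) ((𝓡 m).prod 𝓘(ℝ, F)) (fun y => TotalSpace.mk' F y (f y)) y →
      MDifferentiableAt (𝓡 m) ((𝓡 m).prod 𝓘(ℝ, F)) (fun y => TotalSpace.mk' F y (g y)) y →
      (∀ᶠ w in 𝓝 y, f w = z • g w) →
      ∀ v : TangentSpace (𝓡 m) y, D.toFun f y v = z • D.toFun g y v := by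
    intro f g y hf hg hfg v
    rw [← D.smul_section z hg, D.isCovariantDerivativeOnUniv.congr_of_eventuallyEq hf
      (hf.congr_of_eventuallyEq (hfg.mono fun w hw => by simp only [hw])) Filter.univ_mem hfg]
  have key0 : ∀ᶠ y in 𝓝 x, ∀ v : TangentSpace (𝓡 m) y, D.toFun ρ y v = z • D.toFun σ y v := by
    filter_upwards [eventually_mem_nhds_iff.2 ha, eventually_mem_nhds_iff.2 hc,
      h.eventually_nhds] with y hya hyc hy
    exact aux ρ σ y ((hρ.contMDiffAt hyc).mdifferentiableAt (by simp))
      ((hσ.contMDiffAt hya).mdifferentiableAt (by simp)) hy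
  have key : ∀ Z : ∀ x : M, TangentSpace (𝓡 m) x,
      ContMDiffAt (𝓡 m) ((𝓡 m).prod 𝓘(ℝ, EuclideanSpace ℝ (Fin m))) 1 (T% Z) x →
      ∀ v : TangentSpace (𝓡 m) x, D.toFun (fun y => D.toFun ρ y (Z y)) x v =
      z • D.toFun (fun y => D.toFun σ y (Z y)) x v := fun Z hZ =>
    aux _ _ x (D.mdifferentiableAt_apply hc hρ hZ) (D.mdifferentiableAt_apply ha hσ hZ)
      (key0.mono fun y hy => hy (Z y))
  simp only [curvatureExpr, key X hX, key Y hY, key0.self_of_nhds, smul_sub]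

variable [ContMDiffVectorBundle ∞ F E (𝓡 m)]

/-- The curvature `F_D` of the connection at `x`, a two-form with values in the endomorphisms of
the fibre: `F_D(u, v) s = D_X D_Y σ - D_Y D_X σ - D_[X, Y] σ`, evaluated on extensions of the
vectors `u, v, s` to fields `X, Y, σ` that are smooth near `x`. -/
def curvature (D : ComplexConnection m F E) (x : M) (w : Fin 2 → TangentSpace (𝓡 m) x) :
    E x →ₗ[ℂ] E x where
  toFun s := D.curvatureExpr (FiberBundle.extend (EuclideanSpace ℝ (Fin m)) (w 0))
    (FiberBundle.extend (EuclideanSpace ℝ (Fin m)) (w 1)) (FiberBundle.extend F s) x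
  map_add' s t := by
    obtain ⟨a, ha, hσ⟩ := FiberBundle.exists_contMDiffOn_extend (k := ∞) (𝓡 m) F s
    obtain ⟨b, hb, hτ⟩ := FiberBundle.exists_contMDiffOn_extend (k := ∞) (𝓡 m) F t
    obtain ⟨c, hc, hρ⟩ := FiberBundle.exists_contMDiffOn_extend (k := ∞) (𝓡 m) F (s + t)
    exact D.curvatureExpr_add
      (FiberBundle.contMDiffAt_extend (k := 1) (𝓡 m) (EuclideanSpace ℝ (Fin m)) (w 0))
      (FiberBundle.contMDiffAt_extend (k := 1) (𝓡 m) (EuclideanSpace ℝ (Fin m)) (w 1))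
      ha hσ hb hτ hc hρ (extend_add s t)
  map_smul' z s := by
    obtain ⟨a, ha, hσ⟩ := FiberBundle.exists_contMDiffOn_extend (k := ∞) (𝓡 m) F s
    obtain ⟨c, hc, hρ⟩ := FiberBundle.exists_contMDiffOn_extend (k := ∞) (𝓡 m) F (z • s)
    exact D.curvatureExpr_smul z
      (FiberBundle.contMDiffAt_extend (k := 1) (𝓡 m) (EuclideanSpace ℝ (Fin m)) (w 0))
      (FiberBundle.contMDiffAt_extend (k := 1) (𝓡 m) (EuclideanSpace ℝ (Fin m)) (w 1))
      ha hσ hc hρ (extend_smul z s)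

/-- A connection is flat if its curvature vanishes. -/
def IsFlat (D : ComplexConnection m F E) : Prop :=
  ∀ (x : M) (w : Fin 2 → TangentSpace (𝓡 m) x), D.curvature x w = 0

/-- The complex valued four-form `Tr(F_D ∧ F_D)` at the point `x`. -/
def traceSq (D : ComplexConnection m F E) (x : M) :
    (Fin (2 + 2) → TangentSpace (𝓡 m) x) → ℂ :=
  wedge (fun a b : E x →ₗ[ℂ] E x => LinearMap.trace ℂ (E x) (a ∘ₗ b)) (D.curvature x)
    (D.curvature x)

/-- The degree four component `½ Tr((i F_D / 2π)²)` of the Chern character form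
`Tr(exp(i F_D / 2π))` of the connection. -/
def chernCharacterTwo (D : ComplexConnection m F E) (x : M) :
    (Fin (2 + 2) → TangentSpace (𝓡 m) x) → ℂ := fun v =>
  (1 / 2) * (Complex.I / (2 * Real.pi)) ^ 2 * D.traceSq x v

end ComplexConnection

/-- The squared Hilbert-Schmidt norm `Tr(a* a)` of an endomorphism of a Hermitian vector space;
for a skew-Hermitian `a` it is equal to `-Tr(a²)`. -/
def hsNormSq {V : Type*} [NormedAddCommGroup V] [InnerProductSpace ℂ V] [FiniteDimensional ℂ V]
    (a : V →ₗ[ℂ] V) : ℝ :=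
  ∑ k, ‖a (stdOrthonormalBasis ℂ V k)‖ ^ 2

variable (F) in
lemma finiteDimensional_fiber [FiniteDimensional ℂ F] (x : M) : FiniteDimensional ℂ (E x) :=
  Module.Finite.equiv ((trivializationAt F E x).linearEquivAt ℂ x
    (FiberBundle.mem_baseSet_trivializationAt' x)).symm

namespace ComplexConnection

variable [T2Space M] [ContMDiffVectorBundle ∞ F E (𝓡 m)] [FiniteDimensional ℂ F]
  [RiemannianBundle (fun x : M => TangentSpace (𝓡 m) x)]

/-- The squared pointwise norm `|F_D|² = ∑_{i < j} |F_D(eᵢ, eⱼ)|²` of the curvature, for an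
orthonormal basis `eᵢ` of the tangent space. -/
def curvatureNormSq (D : ComplexConnection m F E) (x : M) : ℝ :=
  haveI : FiniteDimensional ℂ (E x) := finiteDimensional_fiber F x
  ∑ i, ∑ j ∈ Finset.Ioi i,
    hsNormSq (D.curvature x ![stdOrthonormalBasis ℝ (TangentSpace (𝓡 m) x) i,
      stdOrthonormalBasis ℝ (TangentSpace (𝓡 m) x) j])

end ComplexConnection
end Bundles

/-! ## Calibrated connections and the Chern number -/

section Calibrated

variable {n : ℕ} {M : Type*} [TopologicalSpace M]
  [ChartedSpace (EuclideanSpace ℝ (Fin (4 + n))) M]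
  [IsManifold (𝓡 (4 + n)) ∞ M] [T2Space M]
  [RiemannianBundle (fun x : M => TangentSpace (𝓡 (4 + n)) x)]
  {F : Type*} [NormedAddCommGroup F] [NormedSpace ℂ F] [FiniteDimensional ℂ F]
  {E : M → Type*} [TopologicalSpace (TotalSpace F E)]
  [∀ x, NormedAddCommGroup (E x)] [∀ x, InnerProductSpace ℂ (E x)]
  [FiberBundle F E] [VectorBundle ℂ F E] [VectorBundle ℝ F E]
  [ContMDiffVectorBundle ∞ F E (𝓡 (4 + n))]

namespace ComplexConnection

/-- A Hermitian connection `D` is calibrated by the `(dim M - 4)`-form `Φ` if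
`q_Φ(F_D) = |F_D|²`, that is, `Tr(F_D ∧ F_D) ∧ Φ = |F_D|² ν_M`. -/
def IsCalibrated (D : ComplexConnection (4 + n) F E) (o : ManifoldOrientation (4 + n) M)
    (Φ : ∀ x : M, TangentSpace (𝓡 (4 + n)) x [⋀^Fin n]→L[ℝ] ℝ) : Prop :=
  D.IsHermitian ∧ ∀ (x : M) (v : Fin (4 + n) → TangentSpace (𝓡 (4 + n)) x),
    wedge (fun a b : ℂ => a * b) (D.traceSq x) (fun w => ((Φ x w : ℝ) : ℂ)) v =
      ((D.curvatureNormSq x * o.volForm x v : ℝ) : ℂ)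

/-- The number `∫_M ch(E) Φ`, computed by means of the connection `D` on `E`. Only the component
of `ch(E)` of degree four contributes, as `Φ` has degree `dim M - 4`. -/
def chernNumber [CompactSpace M] (D : ComplexConnection (4 + n) F E)
    (o : ManifoldOrientation (4 + n) M)
    (Φ : ∀ x : M, TangentSpace (𝓡 (4 + n)) x [⋀^Fin n]→L[ℝ] ℝ) : ℂ :=
  integralForm o fun x =>
    wedge (fun a b : ℂ => a * b) (D.chernCharacterTwo x) (fun w => ((Φ x w : ℝ) : ℂ))

end ComplexConnection

end Calibrated

/-- A Hermitian vector bundle is flat if it has a flat Hermitian connection. -/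
def IsFlatBundle (m : ℕ) {M : Type*} [TopologicalSpace M]
    [ChartedSpace (EuclideanSpace ℝ (Fin m)) M] [IsManifold (𝓡 m) ∞ M] [T2Space M]
    (F : Type*) [NormedAddCommGroup F] [NormedSpace ℂ F]
    (E : M → Type*) [TopologicalSpace (TotalSpace F E)]
    [∀ x, NormedAddCommGroup (E x)] [∀ x, InnerProductSpace ℂ (E x)]
    [FiberBundle F E] [VectorBundle ℂ F E] [VectorBundle ℝ F E]
    [ContMDiffVectorBundle ∞ F E (𝓡 m)] : Prop :=
  ∃ D : ComplexConnection m F E, D.IsHermitian ∧ D.IsFlat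

end

/-! Only the degree-four part of the Chern character pairs with Φ, and ½(i/2π)² = -1/(8π²), so the
number in question is -(1/8π²) ∫ Tr(F ∧ F) ∧ Φ. For the calibrated connection the integrand is
|F_D|² ν_M. Hence the number is real and nonpositive, and since the integrand is continuous it
vanishes only if F_D vanishes everywhere (`exists_integralForm_eq_ofReal`). The rest is independence
of the connection (`integralForm_chernForm_eq`): computed from D the number has the right sign, and
computed from any flat connection it is zero, which closes both equivalences.

Independence is a local matter. A partition of unity subordinate to patches that lie in a chart and
trivialize E joins D to A by finitely many connections D + g(A - D), where consecutive ones differ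
only in a compact subset of one patch (`integralForm_chernForm_eq_of_eqOn_compl`). In a patch the
connection is d + θ and its curvature is conjugate to dθ + θ ∧ θ (`conj_curvature`), so Tr(F ∧ F)
is, up to normalisation, the exterior derivative of the Chern–Simons form tr(θ dθ + ⅔ θ³)
(`signedSum_chernWeil`). As dΦ = 0, the two top-degree forms differ by the exterior derivative of a
compactly supported form, whose integral vanishes (`setIntegral_signedSum_chernWeil_sub_eq_zero`).

Products of forms are handled as signed sums, over all permutations of 4 + n vectors, of expressions
that are not yet antisymmetric; identities between forms then become reindexings (`signedSum_perm`).
To pass between charts, a top-degree form is written as a continuous function times ν_M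
(`exists_continuous_chernForm_eq`), and the absolute density of ν_M obeys the change of variables
formula (`chartIntegral_eq`). -/

noncomputable section

/-! ## Signed sums over permutations -/

section SignedSum

variable {V : Type*} {n : ℕ}

/-- The signed sum over all permutations of the vectors `b`, the first four of which are
handed to the first argument of `g` and the others to the second one. -/
def signedSum (b : Fin (4 + n) → V) (g : (Fin 4 → V) → (Fin n → V) → ℂ) : ℂ :=
  ∑ σ : Equiv.Perm (Fin (4 + n)), ((Equiv.Perm.sign σ : ℤ) : ℂ) *
    g (fun i => b (σ (Fin.castAdd n i))) (fun j => b (σ (Fin.natAdd 4 j)))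

lemma signedSum_add (b : Fin (4 + n) → V) (g g' : (Fin 4 → V) → (Fin n → V) → ℂ) :
    signedSum b (fun x y => g x y + g' x y) = signedSum b g + signedSum b g' := by
  simp [signedSum, mul_add, Finset.sum_add_distrib]

lemma signedSum_sub (b : Fin (4 + n) → V) (g g' : (Fin 4 → V) → (Fin n → V) → ℂ) :
    signedSum b (fun x y => g x y - g' x y) = signedSum b g - signedSum b g' := by
  simp [signedSum, mul_sub, Finset.sum_sub_distrib]

lemma signedSum_mul_left (b : Fin (4 + n) → V) (a : ℂ) (g : (Fin 4 → V) → (Fin n → V) → ℂ) :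
    signedSum b (fun x y => a * g x y) = a * signedSum b g := by
  simp [signedSum, Finset.mul_sum, mul_left_comm]

lemma signedSum_sum {ι : Type*} (s : Finset ι) (b : Fin (4 + n) → V)
    (g : ι → (Fin 4 → V) → (Fin n → V) → ℂ) :
    signedSum b (fun x y => ∑ i ∈ s, g i x y) = ∑ i ∈ s, signedSum b (g i) := by
  simp only [signedSum, Finset.mul_sum]
  exact Finset.sum_comm

/-- A permutation of all the vectors changes a signed sum by its sign. -/
lemma signedSum_perm (b : Fin (4 + n) → V) (p : Equiv.Perm (Fin (4 + n)))
    (g g' : (Fin 4 → V) → (Fin n → V) → ℂ)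
    (h : ∀ c : Fin (4 + n) → V,
      g (fun i => c (p (Fin.castAdd n i))) (fun j => c (p (Fin.natAdd 4 j))) =
      g' (fun i => c (Fin.castAdd n i)) (fun j => c (Fin.natAdd 4 j))) :
    signedSum b g' = ((Equiv.Perm.sign p : ℤ) : ℂ) * signedSum b g := by
  unfold signedSum
  rw [Finset.mul_sum]
  -- Reindexing by σ ↦ σp moves p inside the arguments and produces a second factor sign p, which
  -- cancels the first.
  conv_rhs => rw [← Equiv.sum_comp (Equiv.mulRight p)]
  refine Finset.sum_congr rfl fun σ _ => ?_
  have h1 := h (fun k => b (σ k))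
  simp only [Equiv.coe_mulRight, Equiv.Perm.mul_apply, Equiv.Perm.sign_mul]
  rw [h1]
  have h2 : (((Equiv.Perm.sign p : ℤˣ) : ℤ) : ℂ) * ((Equiv.Perm.sign p : ℤ) : ℂ) = 1 := by
    rw [← Int.cast_mul, ← Units.val_mul, Int.units_mul_self]; simp
  push_cast
  linear_combination (-((Equiv.Perm.sign σ : ℤ) : ℂ) *
    g' (fun i => b (σ (Fin.castAdd n i))) (fun j => b (σ (Fin.natAdd 4 j)))) * h2

/-- A permutation of the first four arguments changes a signed sum by its sign. -/
lemma signedSum_perm_four (b : Fin (4 + n) → V) (τ : Equiv.Perm (Fin 4))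
    (g : (Fin 4 → V) → (Fin n → V) → ℂ) :
    signedSum b (fun x y => g (fun i => x (τ i)) y) = ((Equiv.Perm.sign τ : ℤ) : ℂ) *
      signedSum b g := by
  have hs : Equiv.Perm.sign (finSumFinEquiv.permCongr
      (Equiv.Perm.sumCongr τ (1 : Equiv.Perm (Fin n)))) = Equiv.Perm.sign τ := by
    rw [Equiv.Perm.sign_permCongr, Equiv.Perm.sign_sumCongr]; simp
  rw [← hs]
  refine signedSum_perm b _ _ _ fun c => ?_
  simp only [← finSumFinEquiv_apply_left, ← finSumFinEquiv_apply_right, Equiv.permCongr_apply,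
    Equiv.symm_apply_apply, Equiv.Perm.sumCongr_apply, Sum.map_inl, Sum.map_inr,
    Equiv.Perm.coe_one, id_eq]

/-- The index `0` and the last `n` indices, as a block of `n + 1` indices beside `1, 2, 3`. -/
def blockEquiv (n : ℕ) : Fin 3 ⊕ Fin (n + 1) ≃ Fin (4 + n) :=
  Equiv.ofBijective
    (Sum.elim (fun i => Fin.castAdd n i.succ) (Fin.cases (Fin.castAdd n 0) (Fin.natAdd 4))) <| by
    rw [Fintype.bijective_iff_injective_and_card]
    refine ⟨?_, by simp; omega⟩
    rintro (i | i) (j | j) h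
    · simpa using h
    · refine Fin.cases (fun h => ?_) (fun j h => ?_) j h
      · have := congrArg Fin.val h; simp at this
      · have := congrArg Fin.val h; simp at this; omega
    · refine Fin.cases (fun h => ?_) (fun j h => ?_) i h
      · have := congrArg Fin.val h; simp at this
      · have := congrArg Fin.val h; simp at this; omega
    · revert h
      refine Fin.cases ?_ (fun i => ?_) i <;> refine Fin.cases ?_ (fun j => ?_) j <;> intro h
      · rfl
      · have := congrArg Fin.val h; simp at this; omega
      · have := congrArg Fin.val h; simp at this
      · have := congrArg Fin.val h; simp at this; simp; omega

/-- Antisymmetrization of a product in which one factor depends on the arguments `1, 2, 3` and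
the other is a derivative of an alternating map whose alternatization vanishes. -/
lemma signedSum_mul_alternatize_eq_zero [NormedAddCommGroup V] [NormedSpace ℝ V]
    (b : Fin (4 + n) → V) (c : V → V → V → ℂ) (L : V →L[ℝ] V [⋀^Fin n]→L[ℝ] ℝ)
    (hL : ContinuousAlternatingMap.alternatizeUncurryFin L = 0) :
    signedSum b (fun x y => c (x 1) (x 2) (x 3) * ((L (x 0) y : ℝ) : ℂ)) = 0 := by
  set g : (Fin 4 → V) → (Fin n → V) → ℂ :=
    fun x y => c (x 1) (x 2) (x 3) * ((L (x 0) y : ℝ) : ℂ) with hg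
  -- The n + 1 terms of the alternatization of `L` all have the same signed sum: bringing the i-th
  -- argument of the block to the front is a cycle of sign (-1)^i. Their total is zero because `L`
  -- alternatizes to zero, so each one is zero.
  have key : ∀ i : Fin (n + 1), signedSum b (fun x y => c (x 1) (x 2) (x 3) *
      (((-1) ^ (i : ℕ) * L ((Fin.cons (x 0) y : Fin (n + 1) → V) i)
        (i.removeNth (Fin.cons (x 0) y : Fin (n + 1) → V)) : ℝ) : ℂ)) = signedSum b g := by
    intro i
    -- The cycle acts on the block formed by the index 0 and the last n indices; the indices 1, 2, 3
    -- seen by `c` stay fixed.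
    set p := (blockEquiv n).permCongr
      (Equiv.Perm.sumCongr (1 : Equiv.Perm (Fin 3)) i.cycleRange.symm) with hp
    have hs : Equiv.Perm.sign p = (-1) ^ (i : ℕ) := by
      rw [hp, Equiv.Perm.sign_permCongr, Equiv.Perm.sign_sumCongr]
      simp [Fin.sign_cycleRange]
    have h1 : ∀ k : Fin 3, p (Fin.castAdd n k.succ) = Fin.castAdd n k.succ := by
      intro k
      have : Fin.castAdd n k.succ = blockEquiv n (Sum.inl k) := rfl
      rw [this, hp, Equiv.permCongr_apply]; simp
    have hb : ∀ (c : Fin (4 + n) → V) (j : Fin (n + 1)), c (blockEquiv n (Sum.inr j)) =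
        (Fin.cons (c (Fin.castAdd n 0)) (fun k => c (Fin.natAdd 4 k)) : Fin (n + 1) → V) j := by
      intro c j
      refine Fin.cases ?_ (fun j => ?_) j <;> rfl
    have h0 : p (Fin.castAdd n 0) = blockEquiv n (Sum.inr i) := by
      have : Fin.castAdd n 0 = blockEquiv n (Sum.inr 0) := rfl
      rw [this, hp, Equiv.permCongr_apply]; simp
    have h2 : ∀ k : Fin n, p (Fin.natAdd 4 k) = blockEquiv n (Sum.inr (i.succAbove k)) := by
      intro k
      have : Fin.natAdd 4 k = blockEquiv n (Sum.inr k.succ) := rfl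
      rw [this, hp, Equiv.permCongr_apply]; simp
    have h3 := signedSum_perm b p g (fun x y => c (x 1) (x 2) (x 3) *
      ((L ((Fin.cons (x 0) y : Fin (n + 1) → V) i)
        (i.removeNth (Fin.cons (x 0) y : Fin (n + 1) → V)) : ℝ) : ℂ)) (fun v => by
        have e1 := h1 0
        have e2 := h1 1
        have e3 := h1 2
        simp only [Fin.isValue, Fin.succ_zero_eq_one, Fin.succ_one_eq_two] at e1 e2
        have e3' : p (Fin.castAdd n 3) = Fin.castAdd n 3 := e3
        simp only [hg, e1, e2, e3', h0, h2, hb]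
        rfl)
    have h4 : (fun (x : Fin 4 → V) (y : Fin n → V) => c (x 1) (x 2) (x 3) *
      (((-1) ^ (i : ℕ) * L ((Fin.cons (x 0) y : Fin (n + 1) → V) i)
        (i.removeNth (Fin.cons (x 0) y : Fin (n + 1) → V)) : ℝ) : ℂ)) = fun x y =>
        (-1) ^ (i : ℕ) * (c (x 1) (x 2) (x 3) * ((L ((Fin.cons (x 0) y : Fin (n + 1) → V) i)
        (i.removeNth (Fin.cons (x 0) y : Fin (n + 1) → V)) : ℝ) : ℂ)) := by
      funext x y; push_cast; ring
    rw [h4, signedSum_mul_left, h3, hs]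
    push_cast
    rw [← mul_assoc, ← mul_pow]; simp
  have hsum : ∑ i : Fin (n + 1), signedSum b (fun x y => c (x 1) (x 2) (x 3) *
      (((-1) ^ (i : ℕ) * L ((Fin.cons (x 0) y : Fin (n + 1) → V) i)
        (i.removeNth (Fin.cons (x 0) y : Fin (n + 1) → V)) : ℝ) : ℂ)) = 0 := by
    rw [← signedSum_sum]
    have : ∀ (x : Fin 4 → V) (y : Fin n → V), ∑ i : Fin (n + 1), c (x 1) (x 2) (x 3) *
      (((-1) ^ (i : ℕ) * L ((Fin.cons (x 0) y : Fin (n + 1) → V) i)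
        (i.removeNth (Fin.cons (x 0) y : Fin (n + 1) → V)) : ℝ) : ℂ) = 0 := by
      intro x y
      have h := congrArg (fun f => f (Fin.cons (x 0) y)) hL
      simp only [ContinuousAlternatingMap.alternatizeUncurryFin_apply] at h
      rw [← Finset.mul_sum, ← Complex.ofReal_sum]
      have h5 : ∑ i : Fin (n + 1), ((-1) ^ (i : ℕ) * L ((Fin.cons (x 0) y : Fin (n + 1) → V) i)
        (i.removeNth (Fin.cons (x 0) y : Fin (n + 1) → V)) : ℝ) = 0 := by
        simpa [smul_eq_mul] using h
      rw [h5]; simp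
    simp only [this]
    simp [signedSum]
  simp only [key, Finset.sum_const, Finset.card_univ, Fintype.card_fin, nsmul_eq_mul,
    mul_eq_zero] at hsum
  exact hsum.resolve_left (by exact_mod_cast n.succ_ne_zero)

end SignedSum

/-! ## The Chern–Simons form on an open subset of a vector space -/

section ChernSimons

variable {V : Type*} [NormedAddCommGroup V] [NormedSpace ℝ V]
  {𝔸 : Type*} [NormedRing 𝔸] [NormedAlgebra ℝ 𝔸] {n : ℕ}

/-- The curvature `dθ + θ ∧ θ` of an algebra valued one-form `θ`. -/
def localCurvature (θ : V → V →L[ℝ] 𝔸) (z u v : V) : 𝔸 :=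
  fderiv ℝ θ z u v - fderiv ℝ θ z v u + (θ z u * θ z v - θ z v * θ z u)

/-- The product of the Chern–Simons form `tr (θ dθ + ⅔ θ³)` with a form `Φ`, before
antisymmetrization. -/
def chernSimons (tr : 𝔸 →L[ℝ] ℂ) (θ : V → V →L[ℝ] 𝔸) (Φ : V → V [⋀^Fin n]→L[ℝ] ℝ)
    (x : Fin 4 → V) (y : Fin n → V) (z : V) : ℂ :=
  (tr (θ z (x 1) * fderiv ℝ θ z (x 2) (x 3)) + 2 / 3 * tr (θ z (x 1) * θ z (x 2) * θ z (x 3))) *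
    ((Φ z y : ℝ) : ℂ)

/-- The product `tr (F ∧ F) ∧ Φ` for the curvature `F` of `θ`, before antisymmetrization. -/
def chernWeil (tr : 𝔸 →L[ℝ] ℂ) (θ : V → V →L[ℝ] 𝔸) (Φ : V → V [⋀^Fin n]→L[ℝ] ℝ) (z : V)
    (x : Fin 4 → V) (y : Fin n → V) : ℂ :=
  tr (localCurvature θ z (x 0) (x 1) * localCurvature θ z (x 2) (x 3)) * ((Φ z y : ℝ) : ℂ)

variable {tr : 𝔸 →L[ℝ] ℂ} {θ θ' : V → V →L[ℝ] 𝔸} {Φ : V → V [⋀^Fin n]→L[ℝ] ℝ} {U : Set V}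

lemma contDiffOn_apply_alternating (hΦ : ContDiffOn ℝ ∞ Φ U) (y : Fin n → V) :
    ContDiffOn ℝ ∞ (fun z => ((Φ z y : ℝ) : ℂ)) U :=
  (Complex.ofRealCLM.contDiff.comp
    (ContinuousAlternatingMap.apply ℝ V ℝ y).contDiff).comp_contDiffOn hΦ

lemma contDiffOn_fderiv_apply (hU : IsOpen U) (hθ : ContDiffOn ℝ ∞ θ U) (u v : V) :
    ContDiffOn ℝ ∞ (fun z => fderiv ℝ θ z u v) U :=
  ((hθ.fderiv_of_isOpen hU (by simp)).clm_apply contDiffOn_const).clm_apply contDiffOn_const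

lemma contDiffOn_localCurvature (hU : IsOpen U) (hθ : ContDiffOn ℝ ∞ θ U) (u v : V) :
    ContDiffOn ℝ ∞ (fun z => localCurvature θ z u v) U := by
  have h : ∀ w : V, ContDiffOn ℝ ∞ (fun z => θ z w) U := fun w => hθ.clm_apply contDiffOn_const
  exact ((contDiffOn_fderiv_apply hU hθ u v).sub (contDiffOn_fderiv_apply hU hθ v u)).add
    (((h u).mul (h v)).sub ((h v).mul (h u)))

lemma contDiffOn_chernSimons (hU : IsOpen U) (hθ : ContDiffOn ℝ ∞ θ U) (hΦ : ContDiffOn ℝ ∞ Φ U)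
    (x : Fin 4 → V) (y : Fin n → V) : ContDiffOn ℝ ∞ (chernSimons tr θ Φ x y) U := by
  have h : ∀ w : V, ContDiffOn ℝ ∞ (fun z => θ z w) U := fun w => hθ.clm_apply contDiffOn_const
  exact ((tr.contDiff.comp_contDiffOn
    ((h (x 1)).mul (contDiffOn_fderiv_apply hU hθ (x 2) (x 3)))).add
    (contDiffOn_const.mul (tr.contDiff.comp_contDiffOn (((h (x 1)).mul (h (x 2))).mul
      (h (x 3)))))).mul (contDiffOn_apply_alternating hΦ y)

lemma contDiffOn_chernWeil (hU : IsOpen U) (hθ : ContDiffOn ℝ ∞ θ U) (hΦ : ContDiffOn ℝ ∞ Φ U)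
    (x : Fin 4 → V) (y : Fin n → V) : ContDiffOn ℝ ∞ (fun z => chernWeil tr θ Φ z x y) U :=
  (tr.contDiff.comp_contDiffOn ((contDiffOn_localCurvature hU hθ _ _).mul
    (contDiffOn_localCurvature hU hθ _ _))).mul (contDiffOn_apply_alternating hΦ y)

/-- Restriction to a line reduces directional derivatives to one real variable, where the product
rule applies directly to noncommutative products of values of θ. -/
lemma hasDerivAt_comp_line {W : Type*} [NormedAddCommGroup W] [NormedSpace ℝ W] {f : V → W} {z : V}
    (hf : DifferentiableAt ℝ f z) (u : V) :
    HasDerivAt (fun t : ℝ => f (z + t • u)) (fderiv ℝ f z u) 0 := by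
  have line : HasDerivAt (fun t : ℝ => z + t • u) u 0 := by
    simpa using ((hasDerivAt_id (0 : ℝ)).smul_const u).const_add z
  have : HasFDerivAt f (fderiv ℝ f z) (z + (0 : ℝ) • u) := by simpa using hf.hasFDerivAt
  exact this.comp_hasDerivAt (0 : ℝ) line

set_option synthInstance.maxHeartbeats 400000 in
lemma hasDerivAt_fderiv_comp_line {W : Type*} [NormedAddCommGroup W] [NormedSpace ℝ W]
    {f : V → V →L[ℝ] W} {z : V} (hf : DifferentiableAt ℝ (fderiv ℝ f) z) (u v w : V) :
    HasDerivAt (fun t : ℝ => fderiv ℝ f (z + t • u) v w) (fderiv ℝ (fderiv ℝ f) z u v w) 0 := by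
  have h := hasDerivAt_comp_line (W := V →L[ℝ] V →L[ℝ] W) hf u
  simpa using (h.clm_apply (hasDerivAt_const (0 : ℝ) v)).clm_apply (hasDerivAt_const (0 : ℝ) w)

/-- The product rule, arranged so that the derivative of Φ stands alone in the last summand; after
antisymmetrization that summand is a product with dΦ. -/
lemma fderiv_chernSimons (hU : IsOpen U) (hθ : ContDiffOn ℝ ∞ θ U) (hΦ : ContDiffOn ℝ ∞ Φ U)
    {z : V} (hz : z ∈ U) (x : Fin 4 → V) (y : Fin n → V) (u : V) :
    fderiv ℝ (chernSimons tr θ Φ x y) z u =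
      (tr (fderiv ℝ θ z u (x 1) * fderiv ℝ θ z (x 2) (x 3)) +
        tr (θ z (x 1) * fderiv ℝ (fderiv ℝ θ) z u (x 2) (x 3)) +
        2 / 3 * (tr (fderiv ℝ θ z u (x 1) * θ z (x 2) * θ z (x 3)) +
          tr (θ z (x 1) * fderiv ℝ θ z u (x 2) * θ z (x 3)) +
          tr (θ z (x 1) * θ z (x 2) * fderiv ℝ θ z u (x 3)))) * ((Φ z y : ℝ) : ℂ) +
      (tr (θ z (x 1) * fderiv ℝ θ z (x 2) (x 3)) +
        2 / 3 * tr (θ z (x 1) * θ z (x 2) * θ z (x 3))) * ((fderiv ℝ Φ z u y : ℝ) : ℂ) := by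
  have hd := hU.mem_nhds hz
  have dθ : DifferentiableAt ℝ θ z := (hθ.contDiffAt hd).differentiableAt (by simp)
  have dθ' : DifferentiableAt ℝ (fderiv ℝ θ) z :=
    ((hθ.fderiv_of_isOpen (m := ∞) hU (by simp)).contDiffAt hd).differentiableAt (by simp)
  have dΦ : DifferentiableAt ℝ Φ z := (hΦ.contDiffAt hd).differentiableAt (by simp)
  have dc := ((contDiffOn_chernSimons (tr := tr) hU hθ hΦ x y).contDiffAt hd).differentiableAt
    (by simp)
  have lθ : ∀ w : V, HasDerivAt (fun t : ℝ => θ (z + t • u) w) (fderiv ℝ θ z u w) 0 := fun w => by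
    simpa using (hasDerivAt_comp_line (W := V →L[ℝ] 𝔸) dθ u).clm_apply (hasDerivAt_const (0 : ℝ) w)
  have lθ' : HasDerivAt (fun t : ℝ => fderiv ℝ θ (z + t • u) (x 2) (x 3))
      (fderiv ℝ (fderiv ℝ θ) z u (x 2) (x 3)) 0 :=
    hasDerivAt_fderiv_comp_line dθ' u _ _
  have lΦ : HasDerivAt (fun t : ℝ => ((Φ (z + t • u) y : ℝ) : ℂ))
      ((fderiv ℝ Φ z u y : ℝ) : ℂ) 0 := by
    have h1 := hasDerivAt_comp_line (W := V [⋀^Fin n]→L[ℝ] ℝ) dΦ u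
    exact ((Complex.ofRealCLM.comp (ContinuousAlternatingMap.apply ℝ V ℝ y)).hasFDerivAt
      ).comp_hasDerivAt (0 : ℝ) h1
  have ltr : ∀ {f : ℝ → 𝔸} {f' : 𝔸}, HasDerivAt f f' 0 →
      HasDerivAt (fun t => tr (f t)) (tr f') 0 := fun h => tr.hasFDerivAt.comp_hasDerivAt (0 : ℝ) h
  have h1 := ((ltr ((lθ (x 1)).mul lθ')).add ((ltr (((lθ (x 1)).mul (lθ (x 2))).mul
    (lθ (x 3)))).const_mul (2 / 3 : ℂ))).mul lΦ
  have h2 := hasDerivAt_comp_line dc u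
  rw [h2.unique h1]
  simp only [zero_smul, add_zero, map_add, add_mul, Pi.mul_apply, Pi.add_apply]

/-- The exterior derivative of the Chern–Simons form is the trace of the square of the curvature. -/
lemma signedSum_chernWeil (htr : ∀ a b, tr (a * b) = tr (b * a)) (hU : IsOpen U)
    (hθ : ContDiffOn ℝ ∞ θ U) (hΦ : ContDiffOn ℝ ∞ Φ U) {z : V} (hz : z ∈ U)
    (hdΦ : extDeriv Φ z = 0) (b : Fin (4 + n) → V) :
    signedSum b (chernWeil tr θ Φ z) =
      4 * signedSum b (fun x y => fderiv ℝ (chernSimons tr θ Φ x y) z (x 0)) := by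
  have hd := hU.mem_nhds hz
  have hsymm : ∀ u v : V, fderiv ℝ (fderiv ℝ θ) z u v = fderiv ℝ (fderiv ℝ θ) z v u :=
    fun u v => ((hθ.contDiffAt hd).isSymmSndFDerivAt (by rw [minSmoothness_of_isRCLikeNormedField]; exact ENat.LEInfty.out)).eq u v
  simp only [fderiv_chernSimons hU hθ hΦ hz]
  -- The summand containing the derivative of Φ drops out because Φ is closed.
  rw [signedSum_add, signedSum_mul_alternatize_eq_zero b (fun u v w => tr (θ z u *
    fderiv ℝ θ z v w) + 2 / 3 * tr (θ z u * θ z v * θ z w)) (fderiv ℝ Φ z) hdΦ, add_zero]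
  unfold chernWeil localCurvature
  set A := fderiv ℝ θ z
  set B := fderiv ℝ (fderiv ℝ θ) z
  set w := θ z
  set φ : (Fin n → V) → ℂ := fun y => ((Φ z y : ℝ) : ℂ)
  have perm := fun (τ : Equiv.Perm (Fin 4)) (g : (Fin 4 → V) → ℂ) =>
    signedSum_perm_four b τ (fun x y => g x * φ y)
  have s01 : Equiv.Perm.sign (Equiv.swap (0 : Fin 4) 1) = -1 := Equiv.Perm.sign_swap (by decide)
  have s23 : Equiv.Perm.sign (Equiv.swap (2 : Fin 4) 3) = -1 := Equiv.Perm.sign_swap (by decide)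
  have s02 : Equiv.Perm.sign (Equiv.swap (0 : Fin 4) 2) = -1 := Equiv.Perm.sign_swap (by decide)
  have s12 : Equiv.Perm.sign (Equiv.swap (1 : Fin 4) 2) = -1 := Equiv.Perm.sign_swap (by decide)
  have s13 : Equiv.Perm.sign (Equiv.swap (1 : Fin 4) 3) = -1 := Equiv.Perm.sign_swap (by decide)
  have s4 : Equiv.Perm.sign (finRotate 4) = -1 := by decide
  -- From here on only three facts are used: `S` is linear, permuting the four arguments multiplies
  -- it by the sign, and the trace is cyclic.
  set S : ((Fin 4 → V) → ℂ) → ℂ := fun g => signedSum b (fun x y => g x * φ y) with hS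
  have add : ∀ g g' : (Fin 4 → V) → ℂ, S (fun x => g x + g' x) = S g + S g' := fun g g' => by
    simp only [hS, add_mul, signedSum_add]
  have sub : ∀ g g' : (Fin 4 → V) → ℂ, S (fun x => g x - g' x) = S g - S g' := fun g g' => by
    simp only [hS, sub_mul, signedSum_sub]
  have mul : ∀ (a : ℂ) (g : (Fin 4 → V) → ℂ), S (fun x => a * g x) = a * S g := fun a g => by
    simp only [hS, mul_assoc, signedSum_mul_left]
  have perm : ∀ (τ : Equiv.Perm (Fin 4)) (g : (Fin 4 → V) → ℂ),
      S (fun x => g (fun i => x (τ i))) = ((Equiv.Perm.sign τ : ℤ) : ℂ) * S g := fun τ g =>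
    signedSum_perm_four b τ (fun x y => g x * φ y)
  -- The curvature is the antisymmetrization of `P`, that is, F(u, v) = P(u, v) - P(v, u).
  set P : V → V → 𝔸 := fun u v => A u v + w u * w v with hP
  set c : (Fin 4 → V) → ℂ := fun x => tr (A (x 0) (x 1) * w (x 2) * w (x 3)) with hc
  have cyc : ∀ a b c d : 𝔸, tr (a * b * (c * d)) = tr (b * c * (d * a)) := fun a b c d => by
    rw [mul_assoc, htr a]; simp only [mul_assoc]
  -- The three derivative terms of tr θ³ are related by 3-cycles, which are even, together with
  -- cyclicity of the trace. All equal `S c`, so the coefficient 2/3 yields 2 · `S c`, matching the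
  -- two mixed terms of tr(P P) in `hp`.
  have c2 : S (fun x => tr (w (x 1) * A (x 0) (x 2) * w (x 3))) = S c := by
    have h1 := perm (Equiv.swap 1 2 * Equiv.swap 2 3) c
    rw [Equiv.Perm.sign_mul, s12, s23] at h1
    simp only [hc, Equiv.Perm.mul_apply] at h1
    simp only [mul_neg, mul_one, neg_neg, Units.val_one, Int.cast_one, one_mul] at h1
    rw [← h1]
    congr 1; funext x
    rw [mul_assoc, htr]; rfl
  have c3 : S (fun x => tr (w (x 1) * w (x 2) * A (x 0) (x 3))) = S c := by
    have h1 := perm (Equiv.swap 2 3 * Equiv.swap 1 2) c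
    rw [Equiv.Perm.sign_mul, s12, s23] at h1
    simp only [hc, Equiv.Perm.mul_apply] at h1
    simp only [mul_neg, mul_one, neg_neg, Units.val_one, Int.cast_one, one_mul] at h1
    rw [← h1]
    congr 1; funext x
    rw [htr, ← mul_assoc]; rfl
  have c4 : S (fun x => tr (w (x 0) * w (x 1) * A (x 2) (x 3))) = S c := by
    have h1 := perm (Equiv.swap 0 2 * Equiv.swap 1 3) c
    rw [Equiv.Perm.sign_mul, s02, s13] at h1
    simp only [hc, Equiv.Perm.mul_apply] at h1
    simp only [mul_neg, mul_one, neg_neg, Units.val_one, Int.cast_one, one_mul] at h1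
    rw [← h1]
    congr 1; funext x
    rw [htr, ← mul_assoc]; rfl
  -- The second derivative is symmetric in the arguments 0 and 2, whose exchange changes the sign of
  -- `S`; this is d² = 0.
  have e0 : S (fun x => tr (w (x 1) * B (x 0) (x 2) (x 3))) = 0 := by
    have h1 := perm (Equiv.swap 0 2) (fun x => tr (w (x 1) * B (x 0) (x 2) (x 3)))
    have h2 : (fun x : Fin 4 → V => tr (w (x (Equiv.swap 0 2 1)) * B (x (Equiv.swap 0 2 0))
        (x (Equiv.swap 0 2 2)) (x (Equiv.swap 0 2 3)))) =
        fun x => tr (w (x 1) * B (x 0) (x 2) (x 3)) := by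
      funext x; exact congrArg (fun l : V →L[ℝ] 𝔸 => tr (w (x 1) * l (x 3))) (hsymm (x 2) (x 0))
    rw [h2, s02] at h1
    simp only [Units.val_neg, Units.val_one, Int.cast_neg, Int.cast_one] at h1
    linear_combination h1 / 2
  -- The trace of θ⁴ is invariant under the rotation of four arguments, which is an odd permutation.
  have q0 : S (fun x => tr (w (x 0) * w (x 1) * (w (x 2) * w (x 3)))) = 0 := by
    have h1 := perm (finRotate 4) (fun x => tr (w (x 0) * w (x 1) * (w (x 2) * w (x 3))))
    have h2 : (fun x : Fin 4 → V => tr (w (x (finRotate 4 0)) * w (x (finRotate 4 1)) *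
        (w (x (finRotate 4 2)) * w (x (finRotate 4 3))))) =
        fun x => tr (w (x 0) * w (x 1) * (w (x 2) * w (x 3))) := by
      funext x; rw [cyc (w (x 0))]; rfl
    rw [h2, s4] at h1
    simp only [Units.val_neg, Units.val_one, Int.cast_neg, Int.cast_one] at h1
    linear_combination h1 / 2
  have hp : S (fun x => tr (P (x 0) (x 1) * P (x 2) (x 3))) =
      S (fun x => tr (A (x 0) (x 1) * A (x 2) (x 3))) + 2 * S c := by
    have h1 : (fun x : Fin 4 → V => tr (P (x 0) (x 1) * P (x 2) (x 3))) = fun x =>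
        tr (A (x 0) (x 1) * A (x 2) (x 3)) + c x + tr (w (x 0) * w (x 1) * A (x 2) (x 3)) +
          tr (w (x 0) * w (x 1) * (w (x 2) * w (x 3))) := by
      funext x
      simp only [hP, hc, add_mul, mul_add, map_add, mul_assoc]
      ring
    rw [h1, add, add, add, c4, q0]
    ring
  -- Expanding both differences gives four terms with signs, each contributing the same amount to
  -- `S`; hence the factor 4 in the conclusion.
  have p4 : S (fun x => tr ((P (x 0) (x 1) - P (x 1) (x 0)) * (P (x 2) (x 3) - P (x 3) (x 2)))) =
      4 * S (fun x => tr (P (x 0) (x 1) * P (x 2) (x 3))) := by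
    set p : (Fin 4 → V) → ℂ := fun x => tr (P (x 0) (x 1) * P (x 2) (x 3)) with hpd
    have h1 := perm (Equiv.swap 0 1) p
    have h2 := perm (Equiv.swap 2 3) p
    have h3 := perm (Equiv.swap 0 1 * Equiv.swap 2 3) p
    rw [Equiv.Perm.sign_mul, s01, s23] at h3
    rw [s01] at h1
    rw [s23] at h2
    have h4 : (fun x : Fin 4 → V => tr ((P (x 0) (x 1) - P (x 1) (x 0)) *
        (P (x 2) (x 3) - P (x 3) (x 2)))) = fun x => p x - p (fun i => x (Equiv.swap 0 1 i)) -
          (p (fun i => x (Equiv.swap 2 3 i)) -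
            p (fun i => x ((Equiv.swap 0 1 * Equiv.swap 2 3 : Equiv.Perm (Fin 4)) i))) := by
      funext x
      have r1 : p (fun i => x (Equiv.swap 0 1 i)) = tr (P (x 1) (x 0) * P (x 2) (x 3)) := rfl
      have r2 : p (fun i => x (Equiv.swap 2 3 i)) = tr (P (x 0) (x 1) * P (x 3) (x 2)) := rfl
      have r3 : p (fun i => x ((Equiv.swap 0 1 * Equiv.swap 2 3 : Equiv.Perm (Fin 4)) i)) =
        tr (P (x 1) (x 0) * P (x 3) (x 2)) := rfl
      rw [r1, r2, r3]
      simp only [hpd, sub_mul, mul_sub, map_sub]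
    rw [h4, sub, sub, sub, h1, h2, h3]
    push_cast
    ring
  have lhs : ∀ x : Fin 4 → V,
      (A (x 0) (x 1) - A (x 1) (x 0) + (w (x 0) * w (x 1) - w (x 1) * w (x 0))) *
        (A (x 2) (x 3) - A (x 3) (x 2) + (w (x 2) * w (x 3) - w (x 3) * w (x 2))) =
      (P (x 0) (x 1) - P (x 1) (x 0)) * (P (x 2) (x 3) - P (x 3) (x 2)) := fun x => by
    simp only [hP]; congr 1 <;> abel
  have h5 : S (fun x => tr (A (x 0) (x 1) * A (x 2) (x 3)) + tr (w (x 1) * B (x 0) (x 2) (x 3)) +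
      2 / 3 * (tr (A (x 0) (x 1) * w (x 2) * w (x 3)) + tr (w (x 1) * A (x 0) (x 2) * w (x 3)) +
        tr (w (x 1) * w (x 2) * A (x 0) (x 3)))) =
      S (fun x => tr (A (x 0) (x 1) * A (x 2) (x 3))) + 2 * S c := by
    rw [add, add, mul, add, add, c2, c3, e0]
    ring
  have h6 : S (fun x => tr ((A (x 0) (x 1) - A (x 1) (x 0) + (w (x 0) * w (x 1) - w (x 1) * w (x 0)))
      * (A (x 2) (x 3) - A (x 3) (x 2) + (w (x 2) * w (x 3) - w (x 3) * w (x 2))))) =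
      4 * (S (fun x => tr (A (x 0) (x 1) * A (x 2) (x 3))) + 2 * S c) := by
    simp only [lhs]
    rw [p4, hp]
  rw [← h5] at h6
  exact h6

end ChernSimons

/-! ### Stokes' theorem for compactly supported changes of the connection form -/

section Stokes

open MeasureTheory

variable {V : Type*} [NormedAddCommGroup V] [NormedSpace ℝ V] [FiniteDimensional ℝ V]
  [MeasurableSpace V] [BorelSpace V] (μ : Measure V) [μ.IsAddHaarMeasure]

/-- The integral of a directional derivative of a function with compact support in `U`, weighted
by a locally constant function, vanishes. -/
lemma integrableOn_and_setIntegral_mul_fderiv_eq_zero {U K : Set V} (hU : IsOpen U) (hK : IsCompact K)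
    (hKU : K ⊆ U) {h : V → ℂ} (hh : ContDiffOn ℝ ∞ h U) (h0 : ∀ z ∈ U, z ∉ K → h z = 0)
    {s : V → ℂ} (hs : ∀ z ∈ U, ∀ᶠ y in 𝓝 z, s y = s z) (v : V) :
    IntegrableOn (fun z => s z * fderiv ℝ h z v) U μ ∧
      ∫ z in U, s z * fderiv ℝ h z v ∂μ = 0 := by
  -- Extension by zero of the weighted function. Near a point of `U` the weight is constant, so `H`
  -- is as smooth there as `h`; off `K` it is locally zero; and K ⊆ U makes these two cases
  -- exhaustive.
  set H : V → ℂ := K.indicator (fun z => s z * h z) with hH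
  have e1 : ∀ z ∈ U, H =ᶠ[𝓝 z] fun y => s z * h y := by
    intro z hz
    filter_upwards [hs z hz, hU.mem_nhds hz] with y hy hyU
    by_cases hyK : y ∈ K
    · simp [hH, hyK, hy]
    · simp [hH, hyK, h0 y hyU hyK]
  have e2 : ∀ z ∉ K, H =ᶠ[𝓝 z] fun _ => 0 := by
    intro z hz
    filter_upwards [hK.isClosed.isOpen_compl.mem_nhds hz] with y hy
    simp [hH, show y ∉ K from hy]
  have hC : ContDiff ℝ 1 H := by
    rw [contDiff_iff_contDiffAt]
    intro z
    by_cases hz : z ∈ U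
    · exact (contDiffAt_const.mul ((hh.contDiffAt (hU.mem_nhds hz)).of_le (by norm_cast))
        ).congr_of_eventuallyEq (e1 z hz)
    · exact contDiffAt_const.congr_of_eventuallyEq (e2 z fun h => hz (hKU h))
  have hcs : HasCompactSupport H := HasCompactSupport.intro hK fun z hz => by simp [hH, hz]
  have hd : ∀ z, U.indicator (fun z => s z * fderiv ℝ h z v) z = fderiv ℝ H z v := by
    intro z
    by_cases hz : z ∈ U
    · rw [Set.indicator_of_mem hz, (e1 z hz).fderiv_eq,
        fderiv_const_mul ((hh.contDiffAt (hU.mem_nhds hz)).differentiableAt (by simp))]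
      rfl
    · rw [Set.indicator_of_notMem hz, (e2 z fun h => hz (hKU h)).fderiv_eq]
      simp
  rw [← integral_indicator hU.measurableSet, ← integrable_indicator_iff hU.measurableSet]
  rw [funext hd]
  have hi : Integrable (fun z => fderiv ℝ H z v) μ :=
    ((hC.continuous_fderiv one_ne_zero).clm_apply continuous_const).integrable_of_hasCompactSupport
      (hcs.fderiv_apply ℝ v)
  -- Integration by parts against the constant function 1.
  have := integral_mul_fderiv_eq_neg_fderiv_mul_of_integrable (μ := μ) (f := fun _ : V => (1 : ℂ))
    (g := H) (v := v) (by simp) (by simpa using hi)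
    (by simpa using hC.continuous.integrable_of_hasCompactSupport hcs)
    (fun x _ => differentiableAt_const _) (fun x _ => (hC.differentiable one_ne_zero).differentiableAt)
  exact ⟨hi, by simpa using this⟩

variable {𝔸 : Type*} [NormedRing 𝔸] [NormedAlgebra ℝ 𝔸] {n : ℕ}
  {tr : 𝔸 →L[ℝ] ℂ} {θ θ' : V → V →L[ℝ] 𝔸} {Φ : V → V [⋀^Fin n]→L[ℝ] ℝ}

/-- The integral of `tr (F ∧ F) ∧ Φ` over an open set does not change under a compactly supported
change of the connection form. -/
lemma setIntegral_signedSum_chernWeil_sub_eq_zero (htr : ∀ a b, tr (a * b) = tr (b * a))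
    {U K : Set V} (hU : IsOpen U) (hK : IsCompact K) (hKU : K ⊆ U)
    (hθ : ContDiffOn ℝ ∞ θ U) (hθ' : ContDiffOn ℝ ∞ θ' U) (h0 : ∀ z ∈ U, z ∉ K → θ z = θ' z)
    (hΦ : ContDiffOn ℝ ∞ Φ U) (hdΦ : ∀ z ∈ U, extDeriv Φ z = 0)
    {s : V → ℂ} (hs : ∀ z ∈ U, ∀ᶠ y in 𝓝 z, s y = s z) (b : Fin (4 + n) → V) :
    ∫ z in U, s z * (signedSum b (chernWeil tr θ Φ z) - signedSum b (chernWeil tr θ' Φ z)) ∂μ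
      = 0 := by
  set G : Equiv.Perm (Fin (4 + n)) → V → ℂ := fun σ z =>
    chernSimons tr θ Φ (fun i => b (σ (Fin.castAdd n i))) (fun j => b (σ (Fin.natAdd 4 j))) z -
    chernSimons tr θ' Φ (fun i => b (σ (Fin.castAdd n i))) (fun j => b (σ (Fin.natAdd 4 j))) z
    with hG
  have hc := fun (x : Fin 4 → V) (y : Fin n → V) =>
    contDiffOn_chernSimons (tr := tr) hU hθ hΦ x y
  have hc' := fun (x : Fin 4 → V) (y : Fin n → V) =>
    contDiffOn_chernSimons (tr := tr) hU hθ' hΦ x y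
  have hGd : ∀ σ, ContDiffOn ℝ ∞ (G σ) U := fun σ => (hc _ _).sub (hc' _ _)
  -- Off the closed set `K` the two connection forms agree on a whole neighbourhood, so their first
  -- derivatives, which enter the Chern–Simons form, agree too.
  have hG0 : ∀ σ, ∀ z ∈ U, z ∉ K → G σ z = 0 := by
    intro σ z hz hzK
    have h1 : θ =ᶠ[𝓝 z] θ' := by
      filter_upwards [hU.mem_nhds hz, hK.isClosed.isOpen_compl.mem_nhds hzK] with y hy hyK
      exact h0 y hy hyK
    simp only [hG, chernSimons, h1.fderiv_eq, h1.eq_of_nhds, sub_self]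
  have key := fun σ : Equiv.Perm (Fin (4 + n)) =>
    integrableOn_and_setIntegral_mul_fderiv_eq_zero μ hU hK hKU (hGd σ) (hG0 σ) hs
      (b (σ (Fin.castAdd n 0)))
  have hint : ∀ z ∈ U, s z * (signedSum b (chernWeil tr θ Φ z) -
      signedSum b (chernWeil tr θ' Φ z)) = ∑ σ : Equiv.Perm (Fin (4 + n)),
        4 * ((Equiv.Perm.sign σ : ℤ) : ℂ) *
          (s z * fderiv ℝ (G σ) z (b (σ (Fin.castAdd n 0)))) := by
    intro z hz
    have hd : ∀ σ : Equiv.Perm (Fin (4 + n)), fderiv ℝ (G σ) z (b (σ (Fin.castAdd n 0))) =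
        fderiv ℝ (chernSimons tr θ Φ (fun i => b (σ (Fin.castAdd n i)))
          (fun j => b (σ (Fin.natAdd 4 j)))) z (b (σ (Fin.castAdd n 0))) -
        fderiv ℝ (chernSimons tr θ' Φ (fun i => b (σ (Fin.castAdd n i)))
          (fun j => b (σ (Fin.natAdd 4 j)))) z (b (σ (Fin.castAdd n 0))) := by
      intro σ
      rw [hG, fderiv_fun_sub (((hc _ _).contDiffAt (hU.mem_nhds hz)).differentiableAt (by simp))
        (((hc' _ _).contDiffAt (hU.mem_nhds hz)).differentiableAt (by simp))]
      rfl
    rw [signedSum_chernWeil htr hU hθ hΦ hz (hdΦ z hz),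
      signedSum_chernWeil htr hU hθ' hΦ hz (hdΦ z hz), ← mul_sub, ← signedSum_sub]
    simp only [signedSum, hd, Finset.mul_sum]
    exact Finset.sum_congr rfl fun σ _ => by ring
  rw [setIntegral_congr_fun hU.measurableSet hint,
    integral_finsetSum _ fun σ _ => (key σ).1.const_mul _]
  refine Finset.sum_eq_zero fun σ _ => ?_
  rw [integral_const_mul, (key σ).2, mul_zero]

end Stokes

/-! ## Algebra of wedge products -/

section Wedge

variable {T A B : Type*} [AddCommGroup T] [Module ℝ T] [AddCommGroup A] [Module ℝ A]
  [AddCommGroup B] [Module ℝ B]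

/-- The wedge product of multilinear maps is alternating. -/
lemma exists_alternatingMap_eq_wedge (μ : A →ₗ[ℝ] B →ₗ[ℝ] ℂ) {k l : ℕ}
    (α : MultilinearMap ℝ (fun _ : Fin k => T) A) (β : MultilinearMap ℝ (fun _ : Fin l => T) B) :
    ∃ η : T [⋀^Fin (k + l)]→ₗ[ℝ] ℂ, ∀ v, η v = wedge (fun a b => μ a b) α β v := by
  -- The sum in `wedge` runs over all permutations rather than shuffles, so it is the plain
  -- alternatization of the tensor product composed with μ.
  refine ⟨((((k.factorial * l.factorial : ℕ) : ℝ))⁻¹ : ℝ) • MultilinearMap.alternatization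
    (((TensorProduct.lift μ).compMultilinearMap (α.domCoprod β)).domDomCongr finSumFinEquiv),
    fun v => ?_⟩
  rw [AlternatingMap.smul_apply, MultilinearMap.alternatization_apply, wedge, Complex.real_smul]
  congr 1
  · push_cast; rfl
  refine Finset.sum_congr rfl fun σ _ => ?_
  rw [Units.smul_def, zsmul_eq_mul]
  rfl

/-- A wedge product of three factors as one signed sum. -/
lemma wedge_wedge_eq_signedSum {T A : Type*} {n : ℕ} (μ : A → A → ℂ) (α : (Fin 2 → T) → A)
    (β : (Fin n → T) → ℂ) (v : Fin (4 + n) → T) :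
    wedge (k := 4) (fun a b : ℂ => a * b) (wedge μ α α) β v = (4 * (n.factorial : ℂ))⁻¹ *
      signedSum v (fun x y => μ (α ![x 0, x 1]) (α ![x 2, x 3]) * β y) := by
  set g : (Fin 4 → T) → (Fin n → T) → ℂ :=
    fun x y => μ (α ![x 0, x 1]) (α ![x 2, x 3]) * β y with hg
  have h1 : ∀ (x : Fin 4 → T) (y : Fin n → T), wedge (k := 2) (l := 2) μ α α x * β y =
      (4 : ℂ)⁻¹ * ∑ τ : Equiv.Perm (Fin 4),
        ((Equiv.Perm.sign τ : ℤ) : ℂ) * g (fun i => x (τ i)) y := by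
    intro x y
    rw [wedge, mul_assoc, Finset.sum_mul]
    rw [show (((Nat.factorial 2 * Nat.factorial 2 : ℕ) : ℂ))⁻¹ = (4 : ℂ)⁻¹ by
      norm_num [Nat.factorial]]
    congr 1
    refine Finset.sum_congr rfl fun τ _ => ?_
    rw [mul_assoc]
    congr 3
    · congr 1; funext i; fin_cases i <;> rfl
    · congr 1; funext i; fin_cases i <;> rfl
  have h2 : ∀ τ : Equiv.Perm (Fin 4), signedSum v (fun x y => ((Equiv.Perm.sign τ : ℤ) : ℂ) *
      g (fun i => x (τ i)) y) = signedSum v g := by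
    intro τ
    rw [signedSum_mul_left, signedSum_perm_four v τ g, ← mul_assoc, ← Int.cast_mul, ← Units.val_mul,
      Int.units_mul_self]
    simp
  -- All 24 inner permutations contribute equally, and 24 · 1/(2! 2!) = 6; the outer factor 1/(4!
  -- n!) then leaves 1/(4 n!).
  have h3 : signedSum v (fun x y => wedge (k := 2) (l := 2) μ α α x * β y) =
      6 * signedSum v g := by
    simp only [h1]
    rw [signedSum_mul_left, signedSum_sum]
    simp only [h2, Finset.sum_const, Finset.card_univ, Fintype.card_perm, Fintype.card_fin,
      nsmul_eq_mul]
    norm_num [Nat.factorial]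
    ring
  have h4 : wedge (k := 4) (fun a b : ℂ => a * b) (wedge μ α α) β v =
    (((4 : ℕ).factorial * n.factorial : ℕ) : ℂ)⁻¹ *
      signedSum v (fun x y => wedge (k := 2) (l := 2) μ α α x * β y) := rfl
  have h5 : (n.factorial : ℂ) ≠ 0 := by exact_mod_cast n.factorial_ne_zero
  rw [h4, h3]
  norm_num [Nat.factorial]
  field_simp
  ring

lemma wedge_mul_left {T : Type*} {k l : ℕ} (a : ℂ) (α : (Fin k → T) → ℂ) (β : (Fin l → T) → ℂ)
    (v : Fin (k + l) → T) : wedge (fun a b : ℂ => a * b) (fun w => a * α w) β v =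
      a * wedge (fun a b : ℂ => a * b) α β v := by
  simp only [wedge, Finset.mul_sum]
  exact Finset.sum_congr rfl fun σ _ => by ring

/-- A complex valued form of top degree is a multiple of a nonzero real valued one. -/
lemma AlternatingMap.exists_eq_mul_of_basis {m : ℕ} (e : Module.Basis (Fin m) ℝ T)
    (ν : T [⋀^Fin m]→ₗ[ℝ] ℝ) (hν : ν e ≠ 0) (η : T [⋀^Fin m]→ₗ[ℝ] ℂ) :
    ∃ h : ℂ, ∀ v, η v = h * ((ν v : ℝ) : ℂ) := by
  -- The real and imaginary parts of η are each multiples of the determinant of the basis, as is ν;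
  -- comparing the values on `e` gives the quotient.
  refine ⟨η e / ((ν e : ℝ) : ℂ), fun v => ?_⟩
  have h1 := AlternatingMap.eq_smul_basis_det e ((Complex.reLm).compAlternatingMap η)
  have h2 := AlternatingMap.eq_smul_basis_det e ((Complex.imLm).compAlternatingMap η)
  have h3 := congrArg (fun f => f v) (AlternatingMap.eq_smul_basis_det e ν)
  have h1' : (η v).re = (η e).re * e.det v := congrArg (fun f => f v) h1
  have h2' : (η v).im = (η e).im * e.det v := congrArg (fun f => f v) h2
  have h3' : ν v = ν e * e.det v := h3
  have h4 : ((ν e : ℝ) : ℂ) ≠ 0 := by exact_mod_cast hν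
  rw [h3', Complex.ofReal_mul, ← mul_assoc, div_mul_cancel₀ _ h4]
  apply Complex.ext <;> simp [h1', h2']

/-- A form of top degree is multiplied by the determinant under an endomorphism. -/
lemma AlternatingMap.map_comp_eq_det_mul {m : ℕ} (e : Module.Basis (Fin m) ℝ T)
    (ν : T [⋀^Fin m]→ₗ[ℝ] ℝ) (f : T →ₗ[ℝ] T) (v : Fin m → T) :
    ν (fun i => f (v i)) = LinearMap.det f * ν v := by
  have h3 := AlternatingMap.eq_smul_basis_det e ν
  have h3' : ∀ v, ν v = ν e * e.det v := fun v => congrArg (fun f => f v) h3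
  have := Module.Basis.det_comp e f v
  rw [h3', h3' v, show (fun i => f (v i)) = f ∘ v from rfl, this]
  ring

end Wedge

/-- The volume form of an oriented Euclidean space does not vanish on a basis. -/
lemma Orientation.volumeForm_basis_ne_zero {m : ℕ} {T : Type*} [NormedAddCommGroup T]
    [InnerProductSpace ℝ T] [FiniteDimensional ℝ T] [hm : Fact (Module.finrank ℝ T = m)]
    (o : Orientation ℝ T (Fin m)) (e : Module.Basis (Fin m) ℝ T) : o.volumeForm e ≠ 0 := by
  rw [AlternatingMap.map_basis_ne_zero_iff e]
  intro h
  -- A vanishing form would contradict the absolute value 1 taken on an orthonormal basis.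
  have := o.abs_volumeForm_apply_of_orthonormal ((stdOrthonormalBasis ℝ T).reindex
    (finCongr hm.out))
  rw [h] at this
  simp at this

/-! ## Coordinate frames and integration of forms of top degree -/

section ChartFrames

variable {m : ℕ} {M : Type*} [TopologicalSpace M] [ChartedSpace (EuclideanSpace ℝ (Fin m)) M]
  [IsManifold (𝓡 m) ∞ M]

lemma contMDiffAt_extChartAt_symm_target {c : M} {z : EuclideanSpace ℝ (Fin m)}
    (hz : z ∈ (extChartAt (𝓡 m) c).target) :
    ContMDiffAt 𝓘(ℝ, EuclideanSpace ℝ (Fin m)) (𝓡 m) ∞ (extChartAt (𝓡 m) c).symm z :=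
  (contMDiffOn_extChartAt_symm c).contMDiffAt ((isOpen_extChartAt_target c).mem_nhds hz)

lemma isInvertible_mfderiv_extChartAt_symm {c : M} {z : EuclideanSpace ℝ (Fin m)}
    (hz : z ∈ (extChartAt (𝓡 m) c).target) :
    (mfderiv 𝓘(ℝ, EuclideanSpace ℝ (Fin m)) (𝓡 m) (extChartAt (𝓡 m) c).symm z).IsInvertible := by
  have : IsManifold (𝓡 m) 1 M := IsManifold.of_le (n := ∞) (by norm_cast)
  have h := isInvertible_mfderivWithin_extChartAt_symm (I := 𝓡 m) hz
  simpa [mfderivWithin_univ] using h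

/-- The coordinate frame of a chart, as a basis. -/
lemma exists_basis_eq_coordFrame {c : M} {z : EuclideanSpace ℝ (Fin m)}
    (hz : z ∈ (extChartAt (𝓡 m) c).target) :
    ∃ e : Module.Basis (Fin m) ℝ (TangentSpace (𝓡 m) ((extChartAt (𝓡 m) c).symm z)),
      ⇑e = coordFrame c z := by
  obtain ⟨L, hL⟩ := isInvertible_mfderiv_extChartAt_symm hz
  refine ⟨(EuclideanSpace.basisFun (Fin m) ℝ).toBasis.map L.toLinearEquiv, ?_⟩
  funext i
  have h : (EuclideanSpace.basisFun (Fin m) ℝ).toBasis i = EuclideanSpace.single i (1 : ℝ) := by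
    simp
  rw [coordFrame, ← hL]
  exact congrArg L h

variable [RiemannianBundle (fun x : M => TangentSpace (𝓡 m) x)]

/-- The signed Riemannian density `ν_M (∂₁, …, ∂ₘ)` in a chart. -/
def ManifoldOrientation.chartDensity (o : ManifoldOrientation m M) (c : M)
    (z : EuclideanSpace ℝ (Fin m)) : ℝ :=
  o.volForm ((extChartAt (𝓡 m) c).symm z) (coordFrame c z)

lemma ManifoldOrientation.continuousOn_chartDensity (o : ManifoldOrientation m M) (c : M) :
    ContinuousOn (o.chartDensity c) (extChartAt (𝓡 m) c).target :=
  o.coherent c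

lemma ManifoldOrientation.chartDensity_ne_zero (o : ManifoldOrientation m M) {c : M}
    {z : EuclideanSpace ℝ (Fin m)} (hz : z ∈ (extChartAt (𝓡 m) c).target) :
    o.chartDensity c z ≠ 0 := by
  obtain ⟨e, he⟩ := exists_basis_eq_coordFrame hz
  rw [chartDensity, ← he]
  exact (o.orient _).volumeForm_basis_ne_zero e

/-- Every tangent space is by definition the model space, so the same tuple of vectors can be read
at either of two equal points without a cast. -/
lemma ManifoldOrientation.volForm_congr (o : ManifoldOrientation m M) {x y : M} (h : x = y)
    (v : Fin m → EuclideanSpace ℝ (Fin m)) : o.volForm x v = o.volForm y v := by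
  subst h; rfl

/-- The transition map between two charts. -/
lemma contDiffAt_transition {c c' : M} {z : EuclideanSpace ℝ (Fin m)}
    (hz : z ∈ (extChartAt (𝓡 m) c).target)
    (hz' : (extChartAt (𝓡 m) c).symm z ∈ (extChartAt (𝓡 m) c').source) :
    ContDiffAt ℝ ∞ (fun y => extChartAt (𝓡 m) c' ((extChartAt (𝓡 m) c).symm y)) z := by
  rw [← contMDiffAt_iff_contDiffAt]
  exact (contMDiffAt_extChartAt' (by simpa using hz')).comp z (contMDiffAt_extChartAt_symm_target hz)

/-- Near z the inverse chart of `c` factors through that of `c'` by the transition map. The chain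
rule expresses one frame through the other, and a top-degree form picks up the determinant. -/
lemma ManifoldOrientation.chartDensity_transition (o : ManifoldOrientation m M) {c c' : M}
    {z : EuclideanSpace ℝ (Fin m)} (hz : z ∈ (extChartAt (𝓡 m) c).target)
    (hz' : (extChartAt (𝓡 m) c).symm z ∈ (extChartAt (𝓡 m) c').source) :
    o.chartDensity c z =
      (fderiv ℝ (fun y => extChartAt (𝓡 m) c' ((extChartAt (𝓡 m) c).symm y)) z).det *
        o.chartDensity c' (extChartAt (𝓡 m) c' ((extChartAt (𝓡 m) c).symm z)) := by
  set τ := fun y => extChartAt (𝓡 m) c' ((extChartAt (𝓡 m) c).symm y) with hτ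
  have hτz : τ z ∈ (extChartAt (𝓡 m) c').target := (extChartAt (𝓡 m) c').map_source hz'
  have hback : (extChartAt (𝓡 m) c').symm (τ z) = (extChartAt (𝓡 m) c).symm z :=
    (extChartAt (𝓡 m) c').left_inv hz'
  have hev : (extChartAt (𝓡 m) c).symm =ᶠ[𝓝 z] (extChartAt (𝓡 m) c').symm ∘ τ := by
    have h1 := (contMDiffAt_extChartAt_symm_target hz).continuousAt
    filter_upwards [h1.preimage_mem_nhds ((isOpen_extChartAt_source c').mem_nhds hz')] with y hy
    exact ((extChartAt (𝓡 m) c').left_inv hy).symm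
  have hchain : ∀ v : EuclideanSpace ℝ (Fin m),
      (mfderiv 𝓘(ℝ, EuclideanSpace ℝ (Fin m)) (𝓡 m) (extChartAt (𝓡 m) c).symm z v :
        EuclideanSpace ℝ (Fin m)) =
      mfderiv 𝓘(ℝ, EuclideanSpace ℝ (Fin m)) (𝓡 m) (extChartAt (𝓡 m) c').symm (τ z)
        (fderiv ℝ τ z v) := by
    intro v
    have h1 : HasMFDerivAt 𝓘(ℝ, EuclideanSpace ℝ (Fin m)) (𝓡 m) (extChartAt (𝓡 m) c').symm (τ z)
        (mfderiv 𝓘(ℝ, EuclideanSpace ℝ (Fin m)) (𝓡 m) (extChartAt (𝓡 m) c').symm (τ z)) :=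
      ((contMDiffAt_extChartAt_symm_target hτz).mdifferentiableAt (by simp)).hasMFDerivAt
    have h2 : HasMFDerivAt 𝓘(ℝ, EuclideanSpace ℝ (Fin m)) 𝓘(ℝ, EuclideanSpace ℝ (Fin m)) τ z
        (fderiv ℝ τ z) :=
      (((contDiffAt_transition hz hz').differentiableAt (by simp)).hasFDerivAt).hasMFDerivAt
    have h3 := (h1.comp z h2).congr_of_eventuallyEq hev
    rw [h3.mfderiv]
    rfl
  have hframe : (coordFrame c z : Fin m → EuclideanSpace ℝ (Fin m)) = fun i =>
      mfderiv 𝓘(ℝ, EuclideanSpace ℝ (Fin m)) (𝓡 m) (extChartAt (𝓡 m) c').symm (τ z)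
        (fderiv ℝ τ z (EuclideanSpace.single i (1 : ℝ))) := by
    funext i; exact hchain _
  have h1 : o.chartDensity c z = o.volForm ((extChartAt (𝓡 m) c').symm (τ z)) (fun i =>
      mfderiv 𝓘(ℝ, EuclideanSpace ℝ (Fin m)) (𝓡 m) (extChartAt (𝓡 m) c').symm (τ z)
        (fderiv ℝ τ z (EuclideanSpace.single i (1 : ℝ)))) := by
    rw [← hframe]
    exact o.volForm_congr hback.symm (coordFrame c z)
  have h2 := AlternatingMap.map_comp_eq_det_mul (EuclideanSpace.basisFun (Fin m) ℝ).toBasis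
    ((o.volForm ((extChartAt (𝓡 m) c').symm (τ z))).compLinearMap
      (mfderiv 𝓘(ℝ, EuclideanSpace ℝ (Fin m)) (𝓡 m) (extChartAt (𝓡 m) c').symm (τ z)).toLinearMap)
    (fderiv ℝ τ z).toLinearMap (fun i => EuclideanSpace.single i (1 : ℝ))
  rw [h1]
  exact h2

open MeasureTheory

/-- The integral of a function over the domain of a chart against the Riemannian density. -/
def ManifoldOrientation.chartIntegral (o : ManifoldOrientation m M) (c : M) (f : M → ℂ) : ℂ :=
  ∫ z in (extChartAt (𝓡 m) c).target,
    f ((extChartAt (𝓡 m) c).symm z) * ((|o.chartDensity c z| : ℝ) : ℂ)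

/-- The integral of a function supported in two charts may be computed in either of them. -/
lemma ManifoldOrientation.chartIntegral_eq (o : ManifoldOrientation m M) (c c' : M) (f : M → ℂ)
    (hf : ∀ x, f x ≠ 0 → x ∈ (extChartAt (𝓡 m) c).source ∧ x ∈ (extChartAt (𝓡 m) c').source) :
    o.chartIntegral c f = o.chartIntegral c' f := by
  set S : M → M → Set (EuclideanSpace ℝ (Fin m)) := fun a b =>
    (extChartAt (𝓡 m) a).target ∩ (extChartAt (𝓡 m) a).symm ⁻¹' (extChartAt (𝓡 m) b).source
    with hS
  have hSo : ∀ a b, IsOpen (S a b) := fun a b =>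
    (contMDiffOn_extChartAt_symm (n := ∞) a).continuousOn.isOpen_inter_preimage
      (isOpen_extChartAt_target a) (isOpen_extChartAt_source b)
  -- Both integrals may be restricted to the overlap of the charts, since the function vanishes
  -- elsewhere.
  have hres : ∀ a b, (∀ x, f x ≠ 0 → x ∈ (extChartAt (𝓡 m) b).source) →
      o.chartIntegral a f = ∫ z in S a b,
        f ((extChartAt (𝓡 m) a).symm z) * ((|o.chartDensity a z| : ℝ) : ℂ) := by
    intro a b h
    refine setIntegral_eq_of_subset_of_forall_sdiff_eq_zero
      (isOpen_extChartAt_target a).measurableSet Set.inter_subset_left fun z hz => ?_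
    have : f ((extChartAt (𝓡 m) a).symm z) = 0 := by
      by_contra h'
      exact hz.2 ⟨hz.1, h _ h'⟩
    rw [this, zero_mul]
  rw [hres c c' fun x hx => (hf x hx).2, hres c' c fun x hx => (hf x hx).1]
  set τ := fun y => extChartAt (𝓡 m) c' ((extChartAt (𝓡 m) c).symm y) with hτ
  have himg : τ '' S c c' = S c' c := by
    ext y
    constructor
    · rintro ⟨z, ⟨hz, hz'⟩, rfl⟩
      refine ⟨(extChartAt (𝓡 m) c').map_source hz', ?_⟩
      simp only [hτ, Set.mem_preimage]
      rw [(extChartAt (𝓡 m) c').left_inv hz']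
      exact (extChartAt (𝓡 m) c).map_target hz
    · rintro ⟨hy, hy'⟩
      refine ⟨extChartAt (𝓡 m) c ((extChartAt (𝓡 m) c').symm y),
        ⟨(extChartAt (𝓡 m) c).map_source hy', ?_⟩, ?_⟩
      · simp only [Set.mem_preimage]
        rw [(extChartAt (𝓡 m) c).left_inv hy']
        exact (extChartAt (𝓡 m) c').map_target hy
      · simp only [hτ]
        rw [(extChartAt (𝓡 m) c).left_inv hy', (extChartAt (𝓡 m) c').right_inv hy]
  have hinj : Set.InjOn τ (S c c') := by
    intro y hy z hz h
    have h1 := congrArg (extChartAt (𝓡 m) c').symm h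
    simp only [hτ] at h1
    rw [(extChartAt (𝓡 m) c').left_inv hy.2, (extChartAt (𝓡 m) c').left_inv hz.2] at h1
    exact (extChartAt (𝓡 m) c).symm.injOn hy.1 hz.1 h1
  -- Change of variables by the transition map; its Jacobian |det| is exactly the ratio of the
  -- absolute densities.
  rw [← himg, integral_image_eq_integral_abs_det_fderiv_smul volume (hSo c c').measurableSet
    (fun z hz => (((contDiffAt_transition hz.1 hz.2).differentiableAt
      (by simp)).hasFDerivAt).hasFDerivWithinAt) hinj]
  refine setIntegral_congr_fun (hSo c c').measurableSet fun z hz => ?_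
  have hback : (extChartAt (𝓡 m) c').symm (τ z) = (extChartAt (𝓡 m) c).symm z :=
    (extChartAt (𝓡 m) c').left_inv hz.2
  rw [hback, o.chartDensity_transition hz.1 hz.2, abs_mul,
    Complex.real_smul]
  push_cast
  ring

/-- In coordinates the integrand is continuous on the target of the chart and vanishes off a compact
subset of it. -/
lemma ManifoldOrientation.integrableOn_chartIntegral (o : ManifoldOrientation m M) (c : M)
    {f : M → ℂ} (hf : ContinuousOn f (extChartAt (𝓡 m) c).source) {K : Set M} (hK : IsCompact K)
    (hKc : K ⊆ (extChartAt (𝓡 m) c).source) (h0 : ∀ x ∉ K, f x = 0) :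
    IntegrableOn (fun z => f ((extChartAt (𝓡 m) c).symm z) *
      ((|o.chartDensity c z| : ℝ) : ℂ)) (extChartAt (𝓡 m) c).target := by
  have hKi : IsCompact (extChartAt (𝓡 m) c '' K) :=
    hK.image_of_continuousOn ((continuousOn_extChartAt c).mono hKc)
  have hsub : extChartAt (𝓡 m) c '' K ⊆ (extChartAt (𝓡 m) c).target := by
    rintro _ ⟨x, hx, rfl⟩; exact (extChartAt (𝓡 m) c).map_source (hKc hx)
  have hcont : ContinuousOn (fun z => f ((extChartAt (𝓡 m) c).symm z) *
      ((|o.chartDensity c z| : ℝ) : ℂ)) (extChartAt (𝓡 m) c).target :=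
    (hf.comp (continuousOn_extChartAt_symm c) fun z hz => (extChartAt (𝓡 m) c).map_target hz).mul
      (Complex.continuous_ofReal.comp_continuousOn (o.continuousOn_chartDensity c).abs)
  refine ((hcont.mono hsub).integrableOn_compact hKi).of_forall_sdiff_eq_zero
    (isOpen_extChartAt_target c).measurableSet fun z hz => ?_
  rw [h0, zero_mul]
  exact fun h => hz.2 ⟨_, h, (extChartAt (𝓡 m) c).right_inv hz.1⟩

end ChartFrames

/-! ### Integration of top-degree forms by a partition of unity -/

section IntegralForm

open MeasureTheory

variable {m : ℕ} {M : Type*} [TopologicalSpace M] [ChartedSpace (EuclideanSpace ℝ (Fin m)) M]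
  [IsManifold (𝓡 m) ∞ M] [T2Space M] [CompactSpace M]

variable (m M) in
lemma chartPartition_isSubordinate :
    (chartPartition m M).IsSubordinate fun c => (chartAt (EuclideanSpace ℝ (Fin m)) c).source :=
  (SmoothPartitionOfUnity.exists_isSubordinate_chartAt_source (𝓡 m) M).choose_spec

variable (m M) in
lemma chartPartition_finite : {c : M | ∃ x, chartPartition m M c x ≠ 0}.Finite :=
  (chartPartition m M).locallyFinite.finite_nonempty_of_compact

variable (m M) in
/-- The finitely many charts that contribute to integrals. -/
def chartPartitionSupport : Finset M := (chartPartition_finite m M).toFinset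

lemma chartPartition_eq_zero {c : M} (hc : c ∉ chartPartitionSupport m M) (x : M) :
    chartPartition m M c x = 0 := by
  by_contra h
  exact hc ((chartPartition_finite m M).mem_toFinset.2 ⟨x, h⟩)

lemma sum_chartPartition (x : M) :
    ∑ c ∈ chartPartitionSupport m M, chartPartition m M c x = 1 := by
  rw [← (chartPartition m M).sum_eq_one (Set.mem_univ x), finsum_eq_sum_of_support_subset]
  intro c hc
  by_contra h
  exact hc (chartPartition_eq_zero h x)

variable [RiemannianBundle (fun x : M => TangentSpace (𝓡 m) x)]

/-- The orientation sign in the definition of the integral turns the signed density into its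
absolute value, because sign t · t = |t|; and only finitely many functions of the partition are
nonzero. -/
lemma integralForm_eq_sum (o : ManifoldOrientation m M)
    {η : ∀ x : M, (Fin m → TangentSpace (𝓡 m) x) → ℂ} {h : M → ℂ}
    (hη : ∀ x v, η x v = h x * ((o.volForm x v : ℝ) : ℂ)) :
    integralForm o η = ∑ c ∈ chartPartitionSupport m M,
      o.chartIntegral c fun x => ((chartPartition m M c x : ℝ) : ℂ) * h x := by
  have h1 : ∀ c : M, (∫ z in (extChartAt (𝓡 m) c).target,
      ((chartPartition m M c ((extChartAt (𝓡 m) c).symm z) *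
      (SignType.sign (o.volForm ((extChartAt (𝓡 m) c).symm z) (coordFrame c z)) : ℝ) : ℝ) : ℂ) *
      η ((extChartAt (𝓡 m) c).symm z) (coordFrame c z)) =
      o.chartIntegral c fun x => ((chartPartition m M c x : ℝ) : ℂ) * h x := by
    intro c
    refine setIntegral_congr_fun (isOpen_extChartAt_target c).measurableSet fun z hz => ?_
    have h2 : |o.chartDensity c z| = (SignType.sign (o.chartDensity c z) : ℝ) *
      o.chartDensity c z := (sign_mul_self _).symm
    beta_reduce
    rw [hη, h2]
    simp only [ManifoldOrientation.chartDensity]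
    push_cast
    ring
  rw [integralForm]
  simp only [h1]
  refine finsum_eq_sum_of_support_subset _ fun c hc => ?_
  by_contra hcs
  refine hc ?_
  simp [ManifoldOrientation.chartIntegral, chartPartition_eq_zero (show c ∉ _ from hcs)]

lemma integrableOn_chartPartition_mul (o : ManifoldOrientation m M) (c : M) {h : M → ℂ}
    (hh : Continuous h) : IntegrableOn (fun z =>
      ((chartPartition m M c ((extChartAt (𝓡 m) c).symm z) : ℝ) : ℂ) *
        h ((extChartAt (𝓡 m) c).symm z) *
      ((|o.chartDensity c z| : ℝ) : ℂ)) (extChartAt (𝓡 m) c).target := by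
  refine o.integrableOn_chartIntegral c
    (f := fun x => ((chartPartition m M c x : ℝ) : ℂ) * h x) ?_
    (isClosed_tsupport (chartPartition m M c)).isCompact
    (by simpa using chartPartition_isSubordinate m M c) fun x hx => ?_
  · exact ((Complex.continuous_ofReal.comp (chartPartition m M c).contMDiff.continuous).mul
      hh).continuousOn
  · simp [image_eq_zero_of_notMem_tsupport hx]

/-- The integral of a form supported in the domain of a chart may be computed in this chart. -/
lemma integralForm_eq_chartIntegral (o : ManifoldOrientation m M)
    {η : ∀ x : M, (Fin m → TangentSpace (𝓡 m) x) → ℂ} {h : M → ℂ}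
    (hη : ∀ x v, η x v = h x * ((o.volForm x v : ℝ) : ℂ)) (hh : Continuous h) (c : M)
    {K : Set M} (hK : IsCompact K) (hKc : K ⊆ (extChartAt (𝓡 m) c).source)
    (h0 : ∀ x ∉ K, h x = 0) :
    integralForm o η = o.chartIntegral c h := by
  rw [integralForm_eq_sum o hη]
  -- Each product of `h` with a partition function is supported in both charts, so every summand can
  -- be moved to the chart `c`, where the partition functions add up to 1.
  have h1 : ∀ c' : M, (o.chartIntegral c' fun x => ((chartPartition m M c' x : ℝ) : ℂ) * h x) =
      o.chartIntegral c fun x => ((chartPartition m M c' x : ℝ) : ℂ) * h x := by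
    intro c'
    refine o.chartIntegral_eq c' c _ fun x hx => ⟨?_, ?_⟩
    · have h2 := left_ne_zero_of_mul hx
      have : x ∈ tsupport (chartPartition m M c') :=
        subset_tsupport _ (by simpa using h2)
      simpa using chartPartition_isSubordinate m M c' this
    · by_contra h2
      exact right_ne_zero_of_mul hx (h0 x fun h => h2 (hKc h))
  rw [Finset.sum_congr rfl fun c' _ => h1 c']
  simp only [ManifoldOrientation.chartIntegral]
  rw [← integral_finsetSum]
  · refine setIntegral_congr_fun (isOpen_extChartAt_target c).measurableSet fun z _ => ?_
    simp only [← Finset.sum_mul]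
    rw [← Complex.ofReal_sum, sum_chartPartition, Complex.ofReal_one, one_mul]
  · intro c' _
    refine o.integrableOn_chartIntegral c
      (f := fun x => ((chartPartition m M c' x : ℝ) : ℂ) * h x) ?_ hK hKc fun x hx => by
        rw [h0 x hx, mul_zero]
    exact ((Complex.continuous_ofReal.comp (chartPartition m M c').contMDiff.continuous).mul
      hh).continuousOn

/-- Continuity of the coefficients gives integrability in each chart, which additivity of the
Bochner integral requires. -/
lemma integralForm_sub (o : ManifoldOrientation m M)
    {η η' : ∀ x : M, (Fin m → TangentSpace (𝓡 m) x) → ℂ} {h h' : M → ℂ}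
    (hη : ∀ x v, η x v = h x * ((o.volForm x v : ℝ) : ℂ)) (hh : Continuous h)
    (hη' : ∀ x v, η' x v = h' x * ((o.volForm x v : ℝ) : ℂ)) (hh' : Continuous h') :
    integralForm o (fun x v => η x v - η' x v) = integralForm o η - integralForm o η' := by
  rw [integralForm_eq_sum o hη, integralForm_eq_sum o hη', integralForm_eq_sum o (h := h - h')
    (fun x v => by rw [hη, hη', Pi.sub_apply, sub_mul]), ← Finset.sum_sub_distrib]
  refine Finset.sum_congr rfl fun c _ => ?_
  simp only [ManifoldOrientation.chartIntegral]
  rw [← integral_sub (integrableOn_chartPartition_mul o c hh)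
    (integrableOn_chartPartition_mul o c hh')]
  congr 1
  funext z
  simp only [Pi.sub_apply]
  ring

/-- The integral of a nonnegative multiple of the volume form. -/
lemma exists_integralForm_eq_ofReal (o : ManifoldOrientation m M)
    {η : ∀ x : M, (Fin m → TangentSpace (𝓡 m) x) → ℂ} {h : M → ℝ}
    (hη : ∀ x v, η x v = ((h x * o.volForm x v : ℝ) : ℂ)) (hh : Continuous h)
    (h0 : ∀ x, 0 ≤ h x) :
    ∃ r : ℝ, integralForm o η = (r : ℂ) ∧ 0 ≤ r ∧ (r = 0 → ∀ x, h x = 0) := by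
  set G : M → EuclideanSpace ℝ (Fin m) → ℝ := fun c z =>
    chartPartition m M c ((extChartAt (𝓡 m) c).symm z) * h ((extChartAt (𝓡 m) c).symm z) *
      |o.chartDensity c z| with hG
  have hG0 : ∀ c z, 0 ≤ G c z := fun c z =>
    mul_nonneg (mul_nonneg ((chartPartition m M).nonneg c _) (h0 _)) (abs_nonneg _)
  have e1 : ∀ c, (o.chartIntegral c fun x => ((chartPartition m M c x : ℝ) : ℂ) *
      ((h x : ℝ) : ℂ)) = ((∫ z in (extChartAt (𝓡 m) c).target, G c z : ℝ) : ℂ) := by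
    intro c
    rw [← integral_complex_ofReal, ManifoldOrientation.chartIntegral]
    simp only [hG]
    push_cast
    rfl
  refine ⟨∑ c ∈ chartPartitionSupport m M, ∫ z in (extChartAt (𝓡 m) c).target, G c z,
    ?_, Finset.sum_nonneg fun c _ => integral_nonneg (hG0 c), fun hr x => ?_⟩
  · rw [integralForm_eq_sum o (h := fun x => ((h x : ℝ) : ℂ)) fun x v => by rw [hη]; push_cast; rfl]
    simp only [e1]
    push_cast
    rfl
  · have hx1 := sum_chartPartition (m := m) x
    -- The point is examined in a chart whose partition function does not vanish there. All summands
    -- of `r` are nonnegative, so the integral over this chart is zero.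
    obtain ⟨c, hc, hcx⟩ : ∃ c ∈ chartPartitionSupport m M, chartPartition m M c x ≠ 0 := by
      by_contra! hne
      rw [Finset.sum_eq_zero hne] at hx1
      exact zero_ne_one hx1
    have hxc : x ∈ (extChartAt (𝓡 m) c).source := by
      have : x ∈ tsupport (chartPartition m M c) := subset_tsupport _ hcx
      simpa using chartPartition_isSubordinate m M c this
    have hzero := (Finset.sum_eq_zero_iff_of_nonneg fun c _ => integral_nonneg (hG0 c)).1 hr c hc
    have hint : IntegrableOn (G c) (extChartAt (𝓡 m) c).target := by
      have := (integrableOn_chartPartition_mul o c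
        (Complex.continuous_ofReal.comp hh)).re
      refine this.congr (Filter.Eventually.of_forall fun z => ?_)
      simp [hG]
    have hcont : ContinuousOn (G c) (extChartAt (𝓡 m) c).target := by
      have hs := continuousOn_extChartAt_symm (I := 𝓡 m) c
      exact (((chartPartition m M c).contMDiff.continuous.comp_continuousOn hs).mul
        (hh.comp_continuousOn hs)).mul (o.continuousOn_chartDensity c).abs
    have hae := (setIntegral_eq_zero_iff_of_nonneg_ae
      (Filter.Eventually.of_forall (hG0 c)) hint).1 hzero
    -- Vanishing almost everywhere improves to vanishing everywhere, the integrand being continuous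
    -- on an open set.
    have hall := Measure.eqOn_open_of_ae_eq hae (isOpen_extChartAt_target c) hcont
      continuousOn_const
    have hxt := (extChartAt (𝓡 m) c).map_source hxc
    have h2 : G c (extChartAt (𝓡 m) c x) = 0 := hall hxt
    simp only [hG] at h2
    rw [(extChartAt (𝓡 m) c).left_inv hxc] at h2
    rcases mul_eq_zero.1 h2 with h3 | h3
    · exact (mul_eq_zero.1 h3).resolve_left hcx
    · exact absurd (abs_eq_zero.1 h3) (o.chartDensity_ne_zero hxt)

end IntegralForm

/-! ## Connections in a local trivialization -/

section LocalConnection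

variable {m : ℕ} {M : Type*} [TopologicalSpace M] [ChartedSpace (EuclideanSpace ℝ (Fin m)) M]
  [IsManifold (𝓡 m) ∞ M]
  {F : Type*} [NormedAddCommGroup F] [NormedSpace ℂ F]
  {E : M → Type*} [TopologicalSpace (TotalSpace F E)]
  [∀ x, NormedAddCommGroup (E x)] [∀ x, InnerProductSpace ℂ (E x)]
  [FiberBundle F E] [VectorBundle ℂ F E] [VectorBundle ℝ F E]
  [ContMDiffVectorBundle ∞ F E (𝓡 m)]

section Flat

variable (e : Trivialization F (TotalSpace.proj : TotalSpace F E → M)) [MemTrivializationAtlas e]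

lemma contMDiffAt_trivialization_symm_const {x : M} (hx : x ∈ e.baseSet) (f : F) :
    ContMDiffAt (𝓡 m) ((𝓡 m).prod 𝓘(ℝ, F)) ∞ (fun y => TotalSpace.mk' F y (e.symm y f)) x := by
  rw [e.contMDiffAt_section_iff hx]
  refine (contMDiffAt_const (c := f)).congr_of_eventuallyEq ?_
  filter_upwards [e.open_baseSet.mem_nhds hx] with y hy
  rw [e.apply_mk_symm hy]

/-- The flat covariant derivative over the base set of a trivialization. -/
def flatDerivative (σ : ∀ x, E x) (x : M) : TangentSpace (𝓡 m) x →L[ℝ] E x :=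
  (e.symmL ℝ x) ∘L mvfderiv (𝓡 m) (fun y => (e ⟨y, σ y⟩).2) x

/-- A trivialization turns sections into `F`-valued functions, for which the sum and product rules
hold. This derivative is the reference from which the connection form is measured. -/
lemma isCovariantDerivativeOn_flatDerivative :
    IsCovariantDerivativeOn (I := 𝓡 m) F (flatDerivative e) e.baseSet where
  add {σ σ' x} hσ hσ' hx := by
    have h1 := (e.mdifferentiableAt_section_iff (𝓡 m) σ hx).1 hσ
    have h2 := (e.mdifferentiableAt_section_iff (𝓡 m) σ' hx).1 hσ'
    have h3 : (fun y => (e ⟨y, (σ + σ') y⟩).2) =ᶠ[𝓝 x]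
        (fun y => (e ⟨y, σ y⟩).2) + fun y => (e ⟨y, σ' y⟩).2 := by
      filter_upwards [e.open_baseSet.mem_nhds hx] with y hy
      exact (e.linear ℝ hy).map_add (σ y) (σ' y)
    have h4 : mvfderiv (𝓡 m) (fun y => (e ⟨y, (σ + σ') y⟩).2) x =
        mvfderiv (𝓡 m) ((fun y => (e ⟨y, σ y⟩).2) + fun y => (e ⟨y, σ' y⟩).2) x := by
      simp only [mvfderiv, h3.mfderiv_eq]
      rfl
    rw [flatDerivative, h4, mvfderiv_add h1 h2, ContinuousLinearMap.comp_add]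
    rfl
  leibniz {σ g x} hσ hg hx := by
    have h1 := (e.mdifferentiableAt_section_iff (𝓡 m) σ hx).1 hσ
    have h3 : (fun y => (e ⟨y, (g • σ) y⟩).2) =ᶠ[𝓝 x] g • fun y => (e ⟨y, σ y⟩).2 := by
      filter_upwards [e.open_baseSet.mem_nhds hx] with y hy
      exact (e.linear ℝ hy).map_smul (g y) (σ y)
    have h4 : mvfderiv (𝓡 m) (fun y => (e ⟨y, (g • σ) y⟩).2) x =
        mvfderiv (𝓡 m) (g • fun y => (e ⟨y, σ y⟩).2) x := by
      simp only [mvfderiv, h3.mfderiv_eq]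
      rfl
    rw [flatDerivative, h4, mvfderiv_smul hg h1]
    ext v
    simp [flatDerivative]
    rw [e.symmL_apply hx, e.symm_apply_apply_mk hx]

lemma flatDerivative_const {x : M} (hx : x ∈ e.baseSet) (f : F) :
    flatDerivative (m := m) e (fun y => e.symm y f) x = 0 := by
  have h3 : (fun y => (e ⟨y, e.symm y f⟩).2) =ᶠ[𝓝 x] fun _ => f := by
    filter_upwards [e.open_baseSet.mem_nhds hx] with y hy
    rw [e.apply_mk_symm hy]
  have h4 : mvfderiv (𝓡 m) (fun y => (e ⟨y, e.symm y f⟩).2) x =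
      mvfderiv (𝓡 m) (fun _ : M => f) x := by
    simp only [mvfderiv, h3.mfderiv_eq]
    rfl
  rw [flatDerivative, h4, mvfderiv_const, ContinuousLinearMap.comp_zero]

end Flat

namespace ComplexConnection

variable [FiniteDimensional ℂ F]
variable (D : ComplexConnection m F E)
  (e : Trivialization F (TotalSpace.proj : TotalSpace F E → M)) [MemTrivializationAtlas e]

/-- A connection is the sum of the flat derivative and a one-form with values in the
endomorphisms. -/
lemma apply_eq_flatDerivative_add {x : M} (hx : x ∈ e.baseSet) {σ : ∀ x, E x}
    (hσ : MDifferentiableAt (𝓡 m) ((𝓡 m).prod 𝓘(ℝ, F)) (fun y => TotalSpace.mk' F y (σ y)) x)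
    (v : TangentSpace (𝓡 m) x) :
    (e ⟨x, D.toFun σ x v⟩).2 = mvfderiv (𝓡 m) (fun y => (e ⟨y, σ y⟩).2) x v +
      (e ⟨x, D.toFun (fun y => e.symm y (e ⟨x, σ x⟩).2) x v⟩).2 := by
  have hD := D.isCovariantDerivativeOnUniv.mono (Set.subset_univ e.baseSet)
  have h0 := isCovariantDerivativeOn_flatDerivative (m := m) e
  have hc := (contMDiffAt_trivialization_symm_const (m := m) e hx
    (e ⟨x, σ x⟩).2).mdifferentiableAt (by simp)
  -- The difference of two covariant derivatives is tensorial: it depends on the section only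
  -- through its value at x. It can thus be evaluated on the constant section with that value, which
  -- the flat derivative kills.
  have h1 := IsCovariantDerivativeOn.difference_apply hD h0 hx hσ
  have h2 := IsCovariantDerivativeOn.difference_apply hD h0 hx hc
  rw [flatDerivative_const e hx, sub_zero] at h2
  have h3 : e.symm x (e ⟨x, σ x⟩).2 = σ x := e.symm_apply_apply_mk hx _
  rw [h3, h1] at h2
  rw [← h2]
  have h4 := (e.linear ℝ hx).map_sub (D.toFun σ x v) (flatDerivative e σ x v)
  have h5 : (e ⟨x, flatDerivative e σ x v⟩).2 = mvfderiv (𝓡 m) (fun y => (e ⟨y, σ y⟩).2) x v := by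
    rw [flatDerivative, ContinuousLinearMap.comp_apply, e.symmL_apply hx,
      e.apply_mk_symm hx]
  rw [sub_apply, h4, h5, add_sub_cancel]

/-- Complex linearity in `f` comes from locality of `D` and its complex linearity on sections;
continuity in both variables is automatic in finite dimension. -/
lemma exists_connForm {x : M} (hx : x ∈ e.baseSet) :
    ∃ T : TangentSpace (𝓡 m) x →L[ℝ] (F →L[ℂ] F), ∀ v f,
      T v f = (e ⟨x, D.toFun (fun y => e.symm y f) x v⟩).2 := by
  have hc := fun f => (contMDiffAt_trivialization_symm_const (m := m) e hx f).mdifferentiableAt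
    (by simp)
  have hadd : ∀ f g : F, D.toFun (fun y => e.symm y (f + g)) x =
      D.toFun (fun y => e.symm y f) x + D.toFun (fun y => e.symm y g) x := by
    intro f g
    rw [← D.isCovariantDerivativeOnUniv.add (hc f) (hc g)]
    refine D.isCovariantDerivativeOnUniv.congr_of_eventuallyEq (hc _)
      (mdifferentiableAt_add_section (hc f) (hc g)) Filter.univ_mem ?_
    filter_upwards [e.open_baseSet.mem_nhds hx] with y hy
    have := (e.symmL ℝ y).map_add f g
    simpa [e.symmL_apply hy] using this
  have hsmul : ∀ (a : ℂ) (f : F) (v : TangentSpace (𝓡 m) x),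
      D.toFun (fun y => e.symm y (a • f)) x v = a • D.toFun (fun y => e.symm y f) x v := by
    intro a f v
    rw [← D.smul_section a (hc f)]
    have hs : MDifferentiableAt (𝓡 m) ((𝓡 m).prod 𝓘(ℝ, F))
        (fun y => TotalSpace.mk' F y (a • e.symm y f)) x := by
      refine (hc (a • f)).congr_of_eventuallyEq ?_
      filter_upwards [e.open_baseSet.mem_nhds hx] with y hy
      have := (e.symmL ℂ y).map_smul a f
      simp only [e.symmL_apply hy] at this
      rw [this]
    rw [D.isCovariantDerivativeOnUniv.congr_of_eventuallyEq (hc _) hs Filter.univ_mem]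
    filter_upwards [e.open_baseSet.mem_nhds hx] with y hy
    have := (e.symmL ℂ y).map_smul a f
    simpa [e.symmL_apply hy] using this
  let B : TangentSpace (𝓡 m) x →ₗ[ℝ] (F →L[ℂ] F) :=
    { toFun := fun v => LinearMap.toContinuousLinearMap
        { toFun := fun f => (e ⟨x, D.toFun (fun y => e.symm y f) x v⟩).2
          map_add' := fun f g => by
            rw [hadd, add_apply, (e.linear ℝ hx).map_add]
          map_smul' := fun a f => by
            rw [hsmul, (e.linear ℂ hx).map_smul]; rfl }
      map_add' := fun u v => by
        ext f
        change (e ⟨x, D.toFun (fun y => e.symm y f) x (u + v)⟩).2 = _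
        rw [map_add, (e.linear ℝ hx).map_add]
        rfl
      map_smul' := fun a v => by
        ext f
        change (e ⟨x, D.toFun (fun y => e.symm y f) x (a • v)⟩).2 = _
        rw [map_smul, (e.linear ℝ hx).map_smul]
        rfl }
  have : T2Space (TangentSpace (𝓡 m) x) :=
    inferInstanceAs (T2Space (EuclideanSpace ℝ (Fin m)))
  exact ⟨LinearMap.toContinuousLinearMap B, fun v f => rfl⟩

open Classical in
/-- The connection form with respect to a trivialization. -/
def connForm (x : M) : TangentSpace (𝓡 m) x →L[ℝ] (F →L[ℂ] F) :=
  if hx : x ∈ e.baseSet then (D.exists_connForm e hx).choose else 0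

lemma connForm_apply {x : M} (hx : x ∈ e.baseSet) (v : TangentSpace (𝓡 m) x) (f : F) :
    D.connForm e x v f = (e ⟨x, D.toFun (fun y => e.symm y f) x v⟩).2 := by
  rw [connForm, dif_pos hx]
  exact (D.exists_connForm e hx).choose_spec v f

/-- The connection form with respect to a trivialization and a chart. -/
def localConnForm (c : M) (z : EuclideanSpace ℝ (Fin m)) :
    EuclideanSpace ℝ (Fin m) →L[ℝ] (F →L[ℂ] F) :=
  (D.connForm e ((extChartAt (𝓡 m) c).symm z)) ∘L
    (mfderiv 𝓘(ℝ, EuclideanSpace ℝ (Fin m)) (𝓡 m) (extChartAt (𝓡 m) c).symm z)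

variable (m) in
/-- The coordinates of a section with respect to a trivialization and a chart. -/
def localSection (c : M) (σ : ∀ x, E x) (z : EuclideanSpace ℝ (Fin m)) : F :=
  (e ⟨(extChartAt (𝓡 m) c).symm z, σ ((extChartAt (𝓡 m) c).symm z)⟩).2

variable (m) in
/-- The part of the chart domain over which the bundle is trivialized, in coordinates. -/
def localDomain (c : M) : Set (EuclideanSpace ℝ (Fin m)) :=
  (extChartAt (𝓡 m) c).target ∩ (extChartAt (𝓡 m) c).symm ⁻¹' e.baseSet

lemma isOpen_localDomain (c : M) : IsOpen (localDomain m e c) :=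
  (continuousOn_extChartAt_symm c).isOpen_inter_preimage
    (isOpen_extChartAt_target c) e.open_baseSet

/-- The formula D = d + θ in coordinates; the derivative term follows from the chain rule for the
inverse chart. -/
lemma apply_eq_fderiv_add {c : M} {z : EuclideanSpace ℝ (Fin m)} (hz : z ∈ localDomain m e c)
    {σ : ∀ x, E x} (hσ : MDifferentiableAt (𝓡 m) ((𝓡 m).prod 𝓘(ℝ, F))
      (fun y => TotalSpace.mk' F y (σ y)) ((extChartAt (𝓡 m) c).symm z))
    (u : EuclideanSpace ℝ (Fin m)) :
    (e ⟨(extChartAt (𝓡 m) c).symm z, D.toFun σ ((extChartAt (𝓡 m) c).symm z)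
      (mfderiv 𝓘(ℝ, EuclideanSpace ℝ (Fin m)) (𝓡 m) (extChartAt (𝓡 m) c).symm z u)⟩).2 =
    fderiv ℝ (localSection m e c σ) z u + D.localConnForm e c z u (localSection m e c σ z) := by
  rw [D.apply_eq_flatDerivative_add e hz.2 hσ]
  congr 1
  · have h1 := ((e.mdifferentiableAt_section_iff (𝓡 m) σ hz.2).1 hσ).hasMFDerivAt
    have h2 := ((contMDiffAt_extChartAt_symm_target hz.1).mdifferentiableAt (by simp)).hasMFDerivAt
    have h3 := (h1.comp z h2).mfderiv
    rw [mfderiv_eq_fderiv] at h3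
    exact (congrArg (fun L => L u) h3).symm
  · exact (D.connForm_apply e hz.2 _ _).symm

end ComplexConnection

end LocalConnection

/-! ### Smoothness of the connection form in coordinates -/

section LocalCurvature

variable {m : ℕ} {M : Type*} [TopologicalSpace M] [ChartedSpace (EuclideanSpace ℝ (Fin m)) M]
  [IsManifold (𝓡 m) ∞ M]

/-- The coordinate vector field of a chart with constant coordinates `u`. -/
def coordField (c : M) (u : EuclideanSpace ℝ (Fin m)) (y : M) : TangentSpace (𝓡 m) y :=
  (trivializationAt (EuclideanSpace ℝ (Fin m)) (TangentSpace (𝓡 m)) c).symm y u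

lemma contMDiffAt_coordField {c x : M} (hx : x ∈ (extChartAt (𝓡 m) c).source)
    (u : EuclideanSpace ℝ (Fin m)) :
    ContMDiffAt (𝓡 m) ((𝓡 m).prod 𝓘(ℝ, EuclideanSpace ℝ (Fin m))) ∞ (T% (coordField c u)) x := by
  have hx' : x ∈ (trivializationAt (EuclideanSpace ℝ (Fin m))
      (TangentSpace (𝓡 m)) c).baseSet := by simpa using hx
  rw [(trivializationAt (EuclideanSpace ℝ (Fin m))
      (TangentSpace (𝓡 m)) c).contMDiffAt_section_iff hx']
  refine (contMDiffAt_const (c := u)).congr_of_eventuallyEq ?_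
  filter_upwards [(trivializationAt (EuclideanSpace ℝ (Fin m))
      (TangentSpace (𝓡 m)) c).open_baseSet.mem_nhds hx'] with y hy
  exact congrArg Prod.snd (Trivialization.apply_mk_symm _ hy u)

/-- The tangent bundle trivialization at `c` is the derivative of the chart. Smoothness of
coordinate fields can then be taken from the bundle, and their values from the inverse chart. -/
lemma coordField_apply {c : M} {z : EuclideanSpace ℝ (Fin m)}
    (hz : z ∈ (extChartAt (𝓡 m) c).target) (u : EuclideanSpace ℝ (Fin m)) :
    coordField c u ((extChartAt (𝓡 m) c).symm z) =
      mfderiv 𝓘(ℝ, EuclideanSpace ℝ (Fin m)) (𝓡 m) (extChartAt (𝓡 m) c).symm z u := by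
  have hy : (extChartAt (𝓡 m) c).symm z ∈ (chartAt (EuclideanSpace ℝ (Fin m)) c).source := by
    simpa using (extChartAt (𝓡 m) c).map_target hz
  have h1 := TangentBundle.symmL_trivializationAt (I := 𝓡 m) hy
  have h2 : ∀ w, w = z → ∀ y, y = (extChartAt (𝓡 m) c).symm z →
      (mfderivWithin 𝓘(ℝ, EuclideanSpace ℝ (Fin m)) (𝓡 m) (extChartAt (𝓡 m) c).symm
        (Set.range (𝓡 m)) w u : EuclideanSpace ℝ (Fin m)) =
      mfderiv 𝓘(ℝ, EuclideanSpace ℝ (Fin m)) (𝓡 m) (extChartAt (𝓡 m) c).symm z u := by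
    rintro w rfl y rfl
    simp [mfderivWithin_univ]
  have h3 := congrArg (fun L => L u) h1
  refine Eq.trans ?_ (h3.trans (h2 _ ((extChartAt (𝓡 m) c).right_inv hz) _ rfl))
  exact (Trivialization.symmL_apply (R := ℝ) _ (by simpa using hy) u).symm

variable
  {F : Type*} [NormedAddCommGroup F] [NormedSpace ℂ F]
  {E : M → Type*} [TopologicalSpace (TotalSpace F E)]
  [∀ x, NormedAddCommGroup (E x)] [∀ x, InnerProductSpace ℂ (E x)]
  [FiberBundle F E] [VectorBundle ℂ F E] [VectorBundle ℝ F E]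

/-- Restriction of scalars embeds the complex linear maps into the real linear ones, where
smoothness can be tested on vectors; a real linear left inverse, continuous in finite dimension,
brings the conclusion back. -/
lemma contDiffOn_complexCLM_apply [FiniteDimensional ℂ F] {V : Type*} [NormedAddCommGroup V]
    [NormedSpace ℝ V] {g : V → F →L[ℂ] F} {s : Set V}
    (hg : ∀ f, ContDiffOn ℝ ∞ (fun z => g z f) s) : ContDiffOn ℝ ∞ g s := by
  have : FiniteDimensional ℝ F := FiniteDimensional.complexToReal F
  let R : (F →L[ℂ] F) →ₗ[ℝ] (F →L[ℝ] F) :=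
    { toFun := fun a => a.restrictScalars ℝ
      map_add' := fun _ _ => rfl
      map_smul' := fun _ _ => rfl }
  obtain ⟨L, hL⟩ := R.exists_leftInverse_of_injective (by
    rw [LinearMap.ker_eq_bot]
    intro a b hab
    ext f
    exact congrArg (fun T : F →L[ℝ] F => T f) hab)
  have h1 : ContDiffOn ℝ ∞ (fun z => R (g z)) s := contDiffOn_clm_apply.2 hg
  have h2 := (LinearMap.toContinuousLinearMap L).contDiff.comp_contDiffOn (n := ∞) h1
  refine h2.congr fun z _ => ?_
  exact (congrArg (fun T => T (g z)) hL).symm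

namespace ComplexConnection

variable [T2Space M]

/-- If `σ` is smooth near `x` and `Y` is smooth at `x`, then `D_Y σ` is smooth at `x`. -/
lemma contMDiffAt_apply (D : ComplexConnection m F E) {σ : ∀ x, E x} {x : M} {s : Set M}
    (hs : s ∈ 𝓝 x)
    (hσ : ContMDiffOn (𝓡 m) ((𝓡 m).prod 𝓘(ℝ, F)) ∞ (fun y => TotalSpace.mk' F y (σ y)) s)
    {Y : ∀ x : M, TangentSpace (𝓡 m) x} (hY : ContMDiffAt (𝓡 m)
      ((𝓡 m).prod 𝓘(ℝ, EuclideanSpace ℝ (Fin m))) ∞ (T% Y) x) :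
    ContMDiffAt (𝓡 m) ((𝓡 m).prod 𝓘(ℝ, F)) ∞
      (fun y => TotalSpace.mk' F y (D.toFun σ y (Y y))) x := by
  obtain ⟨u, hus, huo, hxu⟩ := mem_nhds_iff.1 hs
  -- Smoothness of `D` concerns global sections, so σ is cut off by a bump function equal to 1 near
  -- x; locality of `D` shows that this changes nothing near x.
  obtain ⟨f, -, hf⟩ := (SmoothBumpFunction.nhds_basis_tsupport (I := 𝓡 m) x).mem_iff.1
    (huo.mem_nhds hxu)
  have h1 := ContMDiffOn.smul_section_of_tsupport (n := ∞) (f.contMDiff.contMDiffOn (s := u))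
    huo hf (hσ.mono hus)
  have h2 := (D.smooth.contMDiff (σ := (f : M → ℝ) • σ) (by simpa using h1.contMDiffOn))
  have h4 := (h2.contMDiffAt Filter.univ_mem).clm_bundle_apply hY
  refine h4.congr_of_eventuallyEq ?_
  filter_upwards [f.eventuallyEq_one.eventuallyEq_nhds, huo.mem_nhds hxu] with y hy hyu
  have h5 : MDifferentiableAt (𝓡 m) ((𝓡 m).prod 𝓘(ℝ, F)) (fun y => TotalSpace.mk' F y (σ y)) y :=
    ((hσ.mono hus).contMDiffAt (huo.mem_nhds hyu)).mdifferentiableAt (by simp)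
  have h6 := D.isCovariantDerivativeOnUniv.congr_of_eventuallyEq (σ' := (f : M → ℝ) • σ) h5
    (h1.mdifferentiableAt (by simp)) Filter.univ_mem
    (hy.mono fun z hz => by simp [hz])
  rw [h6]

variable [ContMDiffVectorBundle ∞ F E (𝓡 m)] [FiniteDimensional ℂ F]
variable (D : ComplexConnection m F E)
  (e : Trivialization F (TotalSpace.proj : TotalSpace F E → M)) [MemTrivializationAtlas e]

lemma contDiffAt_localSection {c : M} {σ : ∀ x, E x} {k : ℕ∞ω} {z : EuclideanSpace ℝ (Fin m)}
    (hk : k ≤ ∞) (hz : z ∈ localDomain m e c)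
    (hσ : ContMDiffAt (𝓡 m) ((𝓡 m).prod 𝓘(ℝ, F)) k (fun y => TotalSpace.mk' F y (σ y))
      ((extChartAt (𝓡 m) c).symm z)) :
    ContDiffAt ℝ k (localSection m e c σ) z := by
  rw [← contMDiffAt_iff_contDiffAt]
  have : IsManifold (𝓡 m) k M := IsManifold.of_le hk
  have : ContMDiffVectorBundle k F E (𝓡 m) := ContMDiffVectorBundle.of_le hk
  exact ((e.contMDiffAt_section_iff hz.2).1 hσ).comp z
    ((contMDiffAt_extChartAt_symm_target hz.1).of_le hk)

/-- On constant vectors `u` and `f` the connection form is the coordinate expression of `D` applied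
to a constant section along a coordinate field, and both of these are smooth. -/
lemma contDiffOn_localConnForm (c : M) :
    ContDiffOn ℝ ∞ (D.localConnForm e c) (localDomain m e c) := by
  refine contDiffOn_clm_apply.2 fun u => contDiffOn_complexCLM_apply fun f => ?_
  intro z hz
  refine ContDiffAt.contDiffWithinAt ?_
  have h1 : ContMDiffOn (𝓡 m) ((𝓡 m).prod 𝓘(ℝ, F)) ∞
      (fun y => TotalSpace.mk' F y (e.symm y f)) e.baseSet := fun y hy =>
    (contMDiffAt_trivialization_symm_const e hy f).contMDiffWithinAt
  have h2 := D.contMDiffAt_apply (e.open_baseSet.mem_nhds hz.2) h1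
    (contMDiffAt_coordField ((extChartAt (𝓡 m) c).map_target hz.1) u)
  refine (contDiffAt_localSection e (le_refl _) hz h2).congr_of_eventuallyEq ?_
  filter_upwards [(isOpen_localDomain e c).mem_nhds hz] with w hw
  rw [localSection, coordField_apply hw.1]
  exact D.connForm_apply e hw.2 _ f

end ComplexConnection

end LocalCurvature

/-! ### The commutator of covariant derivatives on a trivial bundle -/

section EuclideanCurvature

variable {V F : Type*} [NormedAddCommGroup V] [NormedSpace ℝ V] [NormedAddCommGroup F]
  [NormedSpace ℂ F]

/-- The covariant derivative given by a connection form on a trivial bundle. -/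
def localDerivative (θ : V → V →L[ℝ] (F →L[ℂ] F)) (Y : V → V) (s : V → F) (z : V) : F :=
  fderiv ℝ s z (Y z) + θ z (Y z) (s z)

lemma fderiv_localDerivative {θ : V → V →L[ℝ] (F →L[ℂ] F)} {Y : V → V} {s : V → F} {z : V}
    (hθ : DifferentiableAt ℝ θ z) (hY : DifferentiableAt ℝ Y z) (hs : ContDiffAt ℝ 2 s z) (u : V) :
    fderiv ℝ (localDerivative θ Y s) z u =
      fderiv ℝ (fderiv ℝ s) z u (Y z) + fderiv ℝ s z (fderiv ℝ Y z u) +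
        (fderiv ℝ θ z u (Y z) (s z) + θ z (fderiv ℝ Y z u) (s z) +
          θ z (Y z) (fderiv ℝ s z u)) := by
  have hs1 : HasFDerivAt s (fderiv ℝ s z) z := (hs.differentiableAt (by simp)).hasFDerivAt
  have hs2 : HasFDerivAt (fderiv ℝ s) (fderiv ℝ (fderiv ℝ s) z) z :=
    ((hs.fderiv_right (m := 1) (by norm_num)).differentiableAt (by simp)).hasFDerivAt
  have h1 := hs2.clm_apply hY.hasFDerivAt
  have h2 := hθ.hasFDerivAt.clm_apply hY.hasFDerivAt
  -- The values of θ are complex linear operators; the product rule is applied to them as real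
  -- linear ones.
  have h3 := ((ContinuousLinearMap.restrictScalarsL ℂ F F ℝ ℝ).hasFDerivAt.comp z h2).clm_apply hs1
  have h4 := (h1.add h3).fderiv
  have h5 := congrArg (fun L => L u) h4
  refine Eq.trans h5 ?_
  simp
  abel

/-- The curvature of a connection on a trivial bundle. -/
lemma localDerivative_commutator {θ : V → V →L[ℝ] (F →L[ℂ] F)} {X Y : V → V} {s : V → F} {z : V}
    (hθ : DifferentiableAt ℝ θ z) (hX : DifferentiableAt ℝ X z) (hY : DifferentiableAt ℝ Y z)
    (hs : ContDiffAt ℝ 2 s z) :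
    localDerivative θ X (localDerivative θ Y s) z - localDerivative θ Y (localDerivative θ X s) z -
      localDerivative θ (VectorField.lieBracket ℝ X Y) s z =
    localCurvature θ z (X z) (Y z) (s z) := by
  -- Second derivatives of `s` cancel by symmetry, mixed terms in θ and ds cancel in pairs, and the
  -- derivatives of `X` and `Y` are absorbed by the bracket. What survives is dθ + θ ∧ θ.
  have hsymm := (hs.isSymmSndFDerivAt (by simp)).eq (X z) (Y z)
  rw [localDerivative, localDerivative.eq_def θ Y (localDerivative θ X s),
    fderiv_localDerivative hθ hY hs, fderiv_localDerivative hθ hX hs, hsymm]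
  simp only [localDerivative, localCurvature, VectorField.lieBracket_eq, map_sub, map_add,
    sub_apply, add_apply, mul_apply_eq_comp]
  abel

end EuclideanCurvature

/-! ### The curvature in local coordinates -/

section LocalCurvature

variable {m : ℕ} {M : Type*} [TopologicalSpace M] [ChartedSpace (EuclideanSpace ℝ (Fin m)) M]
  [IsManifold (𝓡 m) ∞ M]

/-- The coordinates of a vector field in a chart. -/
def chartField (c : M) (X : ∀ x : M, TangentSpace (𝓡 m) x) (z : EuclideanSpace ℝ (Fin m)) :
    EuclideanSpace ℝ (Fin m) :=
  VectorField.mpullback 𝓘(ℝ, EuclideanSpace ℝ (Fin m)) (𝓡 m) (extChartAt (𝓡 m) c).symm X z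

lemma differentiableAt_chartField {c : M} {X : ∀ x : M, TangentSpace (𝓡 m) x}
    {z : EuclideanSpace ℝ (Fin m)} (hz : z ∈ (extChartAt (𝓡 m) c).target)
    (hX : ContMDiffAt (𝓡 m) ((𝓡 m).prod 𝓘(ℝ, EuclideanSpace ℝ (Fin m))) 1 (T% X)
      ((extChartAt (𝓡 m) c).symm z)) :
    DifferentiableAt ℝ (chartField c X) z := by
  have h := ContMDiffAt.mpullback_vectorField_preimage hX (contMDiffAt_extChartAt_symm_target hz)
    (isInvertible_mfderiv_extChartAt_symm hz) (by norm_num; exact ENat.LEInfty.out)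
  have h' := contMDiffAt_vectorSpace_iff_contDiffAt.1 h
  exact h'.differentiableAt one_ne_zero

lemma mfderiv_chartField {c : M} (X : ∀ x : M, TangentSpace (𝓡 m) x)
    {z : EuclideanSpace ℝ (Fin m)} (hz : z ∈ (extChartAt (𝓡 m) c).target) :
    mfderiv 𝓘(ℝ, EuclideanSpace ℝ (Fin m)) (𝓡 m) (extChartAt (𝓡 m) c).symm z
      (chartField c X z) = X ((extChartAt (𝓡 m) c).symm z) :=
  (isInvertible_mfderiv_extChartAt_symm hz).self_apply_inverse _

lemma chartField_eq {c : M} {X : ∀ x : M, TangentSpace (𝓡 m) x}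
    {z : EuclideanSpace ℝ (Fin m)} (hz : z ∈ (extChartAt (𝓡 m) c).target)
    {u : EuclideanSpace ℝ (Fin m)} (hu : X ((extChartAt (𝓡 m) c).symm z) =
      mfderiv 𝓘(ℝ, EuclideanSpace ℝ (Fin m)) (𝓡 m) (extChartAt (𝓡 m) c).symm z u) :
    chartField c X z = u := by
  rw [chartField, VectorField.mpullback_apply, hu]
  exact (isInvertible_mfderiv_extChartAt_symm hz).inverse_apply_self _

/-- Naturality of the Lie bracket under pullback by the inverse chart. -/
lemma chartField_mlieBracket {c : M} {X Y : ∀ x : M, TangentSpace (𝓡 m) x}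
    {z : EuclideanSpace ℝ (Fin m)} (hz : z ∈ (extChartAt (𝓡 m) c).target)
    (hX : MDifferentiableAt (𝓡 m) ((𝓡 m).prod 𝓘(ℝ, EuclideanSpace ℝ (Fin m))) (T% X)
      ((extChartAt (𝓡 m) c).symm z))
    (hY : MDifferentiableAt (𝓡 m) ((𝓡 m).prod 𝓘(ℝ, EuclideanSpace ℝ (Fin m))) (T% Y)
      ((extChartAt (𝓡 m) c).symm z)) :
    chartField c (VectorField.mlieBracket (𝓡 m) X Y) z =
      VectorField.lieBracket ℝ (chartField c X) (chartField c Y) z := by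
  have : IsManifold (𝓡 m) (minSmoothness ℝ 2) M := by
    rw [minSmoothness_of_isRCLikeNormedField]; infer_instance
  have : IsManifold 𝓘(ℝ, EuclideanSpace ℝ (Fin m)) (minSmoothness ℝ 2)
    (EuclideanSpace ℝ (Fin m)) := inferInstance
  rw [chartField, VectorField.mpullback_mlieBracket hX hY (contMDiffAt_extChartAt_symm_target hz)
    (by rw [minSmoothness_of_isRCLikeNormedField]; exact ENat.LEInfty.out),
    ← VectorField.mlieBracketWithin_univ, VectorField.mlieBracketWithin_eq_lieBracketWithin]
  exact congrFun (VectorField.lieBracketWithin_univ (𝕜 := ℝ) (V := chartField c X)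
    (W := chartField c Y)) z

variable
  {F : Type*} [NormedAddCommGroup F] [NormedSpace ℂ F]
  {E : M → Type*} [TopologicalSpace (TotalSpace F E)]
  [∀ x, NormedAddCommGroup (E x)] [∀ x, InnerProductSpace ℂ (E x)]
  [FiberBundle F E] [VectorBundle ℂ F E] [VectorBundle ℝ F E]
  [ContMDiffVectorBundle ∞ F E (𝓡 m)]

namespace ComplexConnection

variable [FiniteDimensional ℂ F] (D : ComplexConnection m F E)
  (e : Trivialization F (TotalSpace.proj : TotalSpace F E → M)) [MemTrivializationAtlas e]

lemma localSection_apply {c : M} {z : EuclideanSpace ℝ (Fin m)} (hz : z ∈ localDomain m e c)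
    {σ : ∀ x, E x} (hσ : MDifferentiableAt (𝓡 m) ((𝓡 m).prod 𝓘(ℝ, F))
      (fun y => TotalSpace.mk' F y (σ y)) ((extChartAt (𝓡 m) c).symm z))
    (Y : ∀ x : M, TangentSpace (𝓡 m) x) :
    localSection m e c (fun y => D.toFun σ y (Y y)) z = localDerivative (D.localConnForm e c)
      (chartField c Y)
      (localSection m e c σ) z := by
  have h := D.apply_eq_fderiv_add e hz hσ
    (chartField c Y z)
  rw [mfderiv_chartField Y hz.1] at h
  exact h

variable [T2Space M]

lemma localSection_curvatureExpr {c : M} {z : EuclideanSpace ℝ (Fin m)}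
    (hz : z ∈ localDomain m e c) {X Y : ∀ x : M, TangentSpace (𝓡 m) x} {σ : ∀ x, E x} {s : Set M}
    (hX : ContMDiffAt (𝓡 m) ((𝓡 m).prod 𝓘(ℝ, EuclideanSpace ℝ (Fin m))) 1 (T% X)
      ((extChartAt (𝓡 m) c).symm z))
    (hY : ContMDiffAt (𝓡 m) ((𝓡 m).prod 𝓘(ℝ, EuclideanSpace ℝ (Fin m))) 1 (T% Y)
      ((extChartAt (𝓡 m) c).symm z))
    (hs : s ∈ 𝓝 ((extChartAt (𝓡 m) c).symm z))
    (hσ : ContMDiffOn (𝓡 m) ((𝓡 m).prod 𝓘(ℝ, F)) ∞ (fun y => TotalSpace.mk' F y (σ y)) s) :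
    localSection m e c (D.curvatureExpr X Y σ) z =
      localCurvature (D.localConnForm e c) z
        (chartField c X z)
        (chartField c Y z)
        (localSection m e c σ z) := by
  have hX' := hX.mdifferentiableAt one_ne_zero
  have hY' := hY.mdifferentiableAt one_ne_zero
  have hσz := hσ.contMDiffAt hs
  -- The equality is needed on a neighbourhood, not just at z, because the outer covariant
  -- derivative differentiates it.
  have hnear : ∀ Z : ∀ x : M, TangentSpace (𝓡 m) x,
      localSection m e c (fun y => D.toFun σ y (Z y)) =ᶠ[𝓝 z] localDerivative (D.localConnForm e c)
      (chartField c Z)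
      (localSection m e c σ) := by
    intro Z
    have hc := (contMDiffAt_extChartAt_symm_target hz.1).continuousAt
    filter_upwards [(isOpen_localDomain e c).mem_nhds hz,
      hc.eventually (eventually_mem_nhds_iff.2 hs)] with w hw hws
    exact D.localSection_apply e hw ((hσ.contMDiffAt hws).mdifferentiableAt (by simp)) Z
  have hsecond : ∀ W Z : ∀ x : M, TangentSpace (𝓡 m) x,
      ContMDiffAt (𝓡 m) ((𝓡 m).prod 𝓘(ℝ, EuclideanSpace ℝ (Fin m))) 1 (T% Z)
        ((extChartAt (𝓡 m) c).symm z) →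
      localSection m e c (fun x => D.toFun (fun y => D.toFun σ y (Z y)) x (W x)) z =
      localDerivative (D.localConnForm e c)
      (chartField c W)
      (localDerivative (D.localConnForm e c)
      (chartField c Z)
      (localSection m e c σ)) z := by
    intro W Z hZ
    rw [D.localSection_apply e hz (D.mdifferentiableAt_apply hs hσ hZ), localDerivative,
      (hnear Z).fderiv_eq, (hnear Z).self_of_nhds]
    rfl
  have hbr := D.localSection_apply e hz (hσz.mdifferentiableAt (by simp))
    (VectorField.mlieBracket (𝓡 m) X Y)
  rw [localDerivative, chartField_mlieBracket hz.1 hX' hY'] at hbr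
  rw [← localDerivative_commutator
    (((D.contDiffOn_localConnForm e c).contDiffAt
      ((isOpen_localDomain e c).mem_nhds hz)).differentiableAt (by simp))
    (differentiableAt_chartField hz.1 hX) (differentiableAt_chartField hz.1 hY)
    (contDiffAt_localSection e ENat.LEInfty.out hz (hσz.of_le ENat.LEInfty.out)),
    ← hsecond X Y hY, ← hsecond Y X hX]
  have hl := (e.linear ℝ hz.2).map_sub
  simp only [localSection] at hbr ⊢
  rw [curvatureExpr, hl, hl, hbr]
  rfl

/-- The curvature in terms of the local connection form. -/
lemma curvature_eq {c : M} {z : EuclideanSpace ℝ (Fin m)}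
    (hz : z ∈ localDomain m e c)
    (u v : EuclideanSpace ℝ (Fin m)) (s : E ((extChartAt (𝓡 m) c).symm z))
    (w : Fin 2 → TangentSpace (𝓡 m) ((extChartAt (𝓡 m) c).symm z))
    (h0 : w 0 = mfderiv 𝓘(ℝ, EuclideanSpace ℝ (Fin m)) (𝓡 m) (extChartAt (𝓡 m) c).symm z u)
    (h1 : w 1 = mfderiv 𝓘(ℝ, EuclideanSpace ℝ (Fin m)) (𝓡 m) (extChartAt (𝓡 m) c).symm z v) :
    e.continuousLinearEquivAt ℂ _ hz.2 (D.curvature ((extChartAt (𝓡 m) c).symm z) w s) =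
      localCurvature (D.localConnForm e c) z u v (e.continuousLinearEquivAt ℂ _ hz.2 s) := by
  obtain ⟨a, ha, hσ⟩ := FiberBundle.exists_contMDiffOn_extend (k := ∞) (𝓡 m) F s
  have h := D.localSection_curvatureExpr e hz
    (FiberBundle.contMDiffAt_extend (k := 1) (𝓡 m) (EuclideanSpace ℝ (Fin m)) (w 0))
    (FiberBundle.contMDiffAt_extend (k := 1) (𝓡 m) (EuclideanSpace ℝ (Fin m)) (w 1)) ha hσ
  rw [chartField_eq hz.1 ((FiberBundle.extend_apply_self _ _).trans h0),
    chartField_eq hz.1 ((FiberBundle.extend_apply_self _ _).trans h1)] at h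
  simp only [localSection, FiberBundle.extend_apply_self] at h
  exact h

end ComplexConnection

end LocalCurvature

/-! ## The curvature as an alternating form, and the Chern–Weil form -/

section CurvatureForm

variable {m : ℕ} {M : Type*} [TopologicalSpace M] [ChartedSpace (EuclideanSpace ℝ (Fin m)) M]
  [IsManifold (𝓡 m) ∞ M] [T2Space M]
  {F : Type*} [NormedAddCommGroup F] [NormedSpace ℂ F] [FiniteDimensional ℂ F]
  {E : M → Type*} [TopologicalSpace (TotalSpace F E)]
  [∀ x, NormedAddCommGroup (E x)] [∀ x, InnerProductSpace ℂ (E x)]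
  [FiberBundle F E] [VectorBundle ℂ F E] [VectorBundle ℝ F E]
  [ContMDiffVectorBundle ∞ F E (𝓡 m)]

variable (F) in
/-- The trace of endomorphisms, as a continuous real linear map. -/
def endTrace : (F →L[ℂ] F) →L[ℝ] ℂ :=
  haveI : FiniteDimensional ℝ (F →L[ℂ] F) := FiniteDimensional.complexToReal _
  LinearMap.toContinuousLinearMap
    { toFun := fun a => LinearMap.trace ℂ F a.toLinearMap
      map_add' := fun a b => by simp
      map_smul' := fun r a => by
        have : (r • a).toLinearMap = (r : ℂ) • a.toLinearMap := by ext; simp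
        rw [this, map_smul]; simp }

lemma endTrace_mul_comm (a b : F →L[ℂ] F) : endTrace F (a * b) = endTrace F (b * a) :=
  LinearMap.trace_mul_comm ℂ a.toLinearMap b.toLinearMap

lemma localCurvature_self {V 𝔸 : Type*} [NormedAddCommGroup V] [NormedSpace ℝ V]
    [NormedRing 𝔸] [NormedAlgebra ℝ 𝔸] (θ : V → V →L[ℝ] 𝔸) (z u : V) :
    localCurvature θ z u u = 0 := by
  simp [localCurvature]

lemma localCurvature_add_left {V 𝔸 : Type*} [NormedAddCommGroup V] [NormedSpace ℝ V]
    [NormedRing 𝔸] [NormedAlgebra ℝ 𝔸] (θ : V → V →L[ℝ] 𝔸) (z u u' v : V) :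
    localCurvature θ z (u + u') v = localCurvature θ z u v + localCurvature θ z u' v := by
  simp only [localCurvature, map_add, add_apply, mul_add, add_mul]
  abel

lemma localCurvature_smul_left {V 𝔸 : Type*} [NormedAddCommGroup V] [NormedSpace ℝ V]
    [NormedRing 𝔸] [NormedAlgebra ℝ 𝔸] (θ : V → V →L[ℝ] 𝔸) (z u v : V) (r : ℝ) :
    localCurvature θ z (r • u) v = r • localCurvature θ z u v := by
  simp only [localCurvature, map_smul, smul_apply, smul_mul_assoc, mul_smul_comm, smul_add,
    smul_sub]

lemma localCurvature_add_right {V 𝔸 : Type*} [NormedAddCommGroup V] [NormedSpace ℝ V]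
    [NormedRing 𝔸] [NormedAlgebra ℝ 𝔸] (θ : V → V →L[ℝ] 𝔸) (z u v v' : V) :
    localCurvature θ z u (v + v') = localCurvature θ z u v + localCurvature θ z u v' := by
  simp only [localCurvature, map_add, add_apply, mul_add, add_mul]
  abel

lemma localCurvature_smul_right {V 𝔸 : Type*} [NormedAddCommGroup V] [NormedSpace ℝ V]
    [NormedRing 𝔸] [NormedAlgebra ℝ 𝔸] (θ : V → V →L[ℝ] 𝔸) (z u v : V) (r : ℝ) :
    localCurvature θ z u (r • v) = r • localCurvature θ z u v := by
  simp only [localCurvature, map_smul, smul_apply, smul_mul_assoc, mul_smul_comm, smul_add,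
    smul_sub]

/-- The local curvature as an alternating map. -/
def localCurvatureForm {V 𝔸 : Type*} [NormedAddCommGroup V] [NormedSpace ℝ V]
    [NormedRing 𝔸] [NormedAlgebra ℝ 𝔸] (θ : V → V →L[ℝ] 𝔸) (z : V) : V [⋀^Fin 2]→ₗ[ℝ] 𝔸 where
  toFun w := localCurvature θ z (w 0) (w 1)
  map_update_add' w i a b := by
    fin_cases i
    · simp [localCurvature_add_left]
    · simp [localCurvature_add_right]
  map_update_smul' w i r a := by
    fin_cases i
    · simp [localCurvature_smul_left]
    · simp [localCurvature_smul_right]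
  map_eq_zero_of_eq' w i j hij hne := by
    have h01 : w 0 = w 1 := by
      fin_cases i <;> fin_cases j <;> first | exact absurd rfl hne | exact hij | exact hij.symm
    rw [h01, localCurvature_self]

/-- Conjugation by an equivalence, as a real linear map. -/
def conjLinear {F W : Type*} [NormedAddCommGroup F] [NormedSpace ℂ F] [NormedAddCommGroup W]
    [NormedSpace ℂ W] (T : F ≃ₗ[ℂ] W) : (F →L[ℂ] F) →ₗ[ℝ] (W →ₗ[ℂ] W) where
  toFun a := T.conj a.toLinearMap
  map_add' a b := map_add T.conj a.toLinearMap b.toLinearMap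
  map_smul' r a := by
    have h1 : (r • a).toLinearMap = (r : ℂ) • a.toLinearMap := by ext; simp
    rw [h1, map_smul]
    ext s
    simp [Complex.coe_smul]

namespace ComplexConnection

variable (D : ComplexConnection m F E)
  (e : Trivialization F (TotalSpace.proj : TotalSpace F E → M)) [MemTrivializationAtlas e]

/-- Puts the curvature in a form to which conjugation invariance of the trace applies. -/
lemma conj_curvature {c : M} {z : EuclideanSpace ℝ (Fin m)} (hz : z ∈ localDomain m e c)
    (u v : EuclideanSpace ℝ (Fin m))
    (w : Fin 2 → TangentSpace (𝓡 m) ((extChartAt (𝓡 m) c).symm z))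
    (h0 : w 0 = mfderiv 𝓘(ℝ, EuclideanSpace ℝ (Fin m)) (𝓡 m) (extChartAt (𝓡 m) c).symm z u)
    (h1 : w 1 = mfderiv 𝓘(ℝ, EuclideanSpace ℝ (Fin m)) (𝓡 m) (extChartAt (𝓡 m) c).symm z v) :
    D.curvature ((extChartAt (𝓡 m) c).symm z) w =
      (e.continuousLinearEquivAt ℂ _ hz.2).toLinearEquiv.symm.conj
        (localCurvature (D.localConnForm e c) z u v).toLinearMap := by
  ext s
  apply (e.continuousLinearEquivAt ℂ _ hz.2).injective
  rw [D.curvature_eq e hz u v s w h0 h1]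
  exact ((e.continuousLinearEquivAt ℂ _ hz.2).apply_symm_apply _).symm

/-- The curvature is an alternating form. -/
lemma exists_alternatingMap_eq_curvature (x : M) :
    ∃ α : TangentSpace (𝓡 m) x [⋀^Fin 2]→ₗ[ℝ] (E x →ₗ[ℂ] E x), ⇑α = D.curvature x := by
  -- The point x equals the inverse chart at its own coordinates only propositionally; with a free
  -- variable `y` the dependent types can be substituted away.
  suffices H : ∀ z, z ∈ localDomain m (trivializationAt F E x) x →
      ∀ y, y = (extChartAt (𝓡 m) x).symm z →
      ∃ α : TangentSpace (𝓡 m) y [⋀^Fin 2]→ₗ[ℝ] (E y →ₗ[ℂ] E y), ⇑α = D.curvature y by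
    refine H (extChartAt (𝓡 m) x x) ⟨mem_extChartAt_target x, ?_⟩ x
      (extChartAt_to_inv x).symm
    simpa using FiberBundle.mem_baseSet_trivializationAt' x
  rintro z hz y rfl
  set e := trivializationAt F E x
  obtain ⟨T, hT⟩ := isInvertible_mfderiv_extChartAt_symm hz.1
  refine ⟨(conjLinear (e.continuousLinearEquivAt ℂ _ hz.2).toLinearEquiv.symm).compAlternatingMap
    ((localCurvatureForm (D.localConnForm e x) z).compLinearMap T.symm.toLinearMap), ?_⟩
  funext w
  refine (D.conj_curvature e hz (T.symm (w 0)) (T.symm (w 1)) w ?_ ?_).symm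
  · rw [← hT]; exact (T.apply_symm_apply _).symm
  · rw [← hT]; exact (T.apply_symm_apply _).symm

end ComplexConnection

end CurvatureForm

/-! ### The top-degree form Tr(F ∧ F) ∧ Φ -/

section ChernWeilForm

variable {n : ℕ} {M : Type*} [TopologicalSpace M]
  [ChartedSpace (EuclideanSpace ℝ (Fin (4 + n))) M]
  [IsManifold (𝓡 (4 + n)) ∞ M] [T2Space M]
  {F : Type*} [NormedAddCommGroup F] [NormedSpace ℂ F] [FiniteDimensional ℂ F]
  {E : M → Type*} [TopologicalSpace (TotalSpace F E)]
  [∀ x, NormedAddCommGroup (E x)] [∀ x, InnerProductSpace ℂ (E x)]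
  [FiberBundle F E] [VectorBundle ℂ F E] [VectorBundle ℝ F E]
  [ContMDiffVectorBundle ∞ F E (𝓡 (4 + n))]

namespace ComplexConnection

variable (D : ComplexConnection (4 + n) F E)
  (e : Trivialization F (TotalSpace.proj : TotalSpace F E → M)) [MemTrivializationAtlas e]

/-- The form `Tr (F_D ∧ F_D) ∧ Φ` of top degree. -/
def chernForm (Φ : ∀ x : M, TangentSpace (𝓡 (4 + n)) x [⋀^Fin n]→L[ℝ] ℝ) (x : M) :
    (Fin (4 + n) → TangentSpace (𝓡 (4 + n)) x) → ℂ :=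
  wedge (fun a b : ℂ => a * b) (D.traceSq x) (fun w => ((Φ x w : ℝ) : ℂ))

lemma trace_curvature_comp {c : M} {z : EuclideanSpace ℝ (Fin (4 + n))}
    (hz : z ∈ localDomain (4 + n) e c) (u v u' v' : EuclideanSpace ℝ (Fin (4 + n)))
    (w w' : Fin 2 → TangentSpace (𝓡 (4 + n)) ((extChartAt (𝓡 (4 + n)) c).symm z))
    (h0 : w 0 = mfderiv 𝓘(ℝ, EuclideanSpace ℝ (Fin (4 + n))) (𝓡 (4 + n))
      (extChartAt (𝓡 (4 + n)) c).symm z u)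
    (h1 : w 1 = mfderiv 𝓘(ℝ, EuclideanSpace ℝ (Fin (4 + n))) (𝓡 (4 + n))
      (extChartAt (𝓡 (4 + n)) c).symm z v)
    (h0' : w' 0 = mfderiv 𝓘(ℝ, EuclideanSpace ℝ (Fin (4 + n))) (𝓡 (4 + n))
      (extChartAt (𝓡 (4 + n)) c).symm z u')
    (h1' : w' 1 = mfderiv 𝓘(ℝ, EuclideanSpace ℝ (Fin (4 + n))) (𝓡 (4 + n))
      (extChartAt (𝓡 (4 + n)) c).symm z v') :
    LinearMap.trace ℂ (E ((extChartAt (𝓡 (4 + n)) c).symm z))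
      (D.curvature ((extChartAt (𝓡 (4 + n)) c).symm z) w ∘ₗ
        D.curvature ((extChartAt (𝓡 (4 + n)) c).symm z) w') =
      endTrace F (localCurvature (D.localConnForm e c) z u v *
        localCurvature (D.localConnForm e c) z u' v') := by
  rw [D.conj_curvature e hz u v w h0 h1, D.conj_curvature e hz u' v' w' h0' h1',
    ← LinearEquiv.conj_comp, LinearMap.trace_conj']
  rfl

/-- The bridge to the computation in Euclidean space: the coordinate frame is the image of the
standard basis under the same derivative by which Φ is pulled back, so the factors with Φ agree by
definition. -/
lemma chernForm_frame (Φ : ∀ x : M, TangentSpace (𝓡 (4 + n)) x [⋀^Fin n]→L[ℝ] ℝ) {c : M}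
    {z : EuclideanSpace ℝ (Fin (4 + n))} (hz : z ∈ localDomain (4 + n) e c) :
    D.chernForm Φ ((extChartAt (𝓡 (4 + n)) c).symm z) (coordFrame c z) =
      (4 * (n.factorial : ℂ))⁻¹ * signedSum (fun i => EuclideanSpace.single i (1 : ℝ))
        (chernWeil (endTrace F) (D.localConnForm e c) (formInChart Φ c) z) := by
  refine (wedge_wedge_eq_signedSum _ _ _ _).trans ?_
  congr 1
  refine Finset.sum_congr rfl fun σ _ => ?_
  congr 1
  refine congrArg₂ (· * ·) ?_ rfl
  exact D.trace_curvature_comp e hz _ _ _ _ _ _ rfl rfl rfl rfl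

variable [RiemannianBundle (fun x : M => TangentSpace (𝓡 (4 + n)) x)]

/-- The form `Tr (F_D ∧ F_D) ∧ Φ` is a continuous multiple of the volume form. -/
lemma exists_continuous_chernForm_eq (o : ManifoldOrientation (4 + n) M)
    {Φ : ∀ x : M, TangentSpace (𝓡 (4 + n)) x [⋀^Fin n]→L[ℝ] ℝ} (hΦ : IsSmoothForm Φ) :
    ∃ h : M → ℂ, Continuous h ∧ ∀ x v, D.chernForm Φ x v = h x * ((o.volForm x v : ℝ) : ℂ) := by
  have hex : ∀ x, ∃ h : ℂ, ∀ v, D.chernForm Φ x v = h * ((o.volForm x v : ℝ) : ℂ) := by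
    intro x
    obtain ⟨α, hα⟩ := D.exists_alternatingMap_eq_curvature x
    obtain ⟨η, hη⟩ := exists_alternatingMap_eq_wedge (k := 2) (l := 2)
      (LinearMap.mk₂ ℝ (fun a b : E x →ₗ[ℂ] E x => LinearMap.trace ℂ (E x) (a ∘ₗ b))
        (fun a b c => by rw [LinearMap.add_comp, map_add])
        (fun r a b => by
          rw [← Complex.coe_smul r a, LinearMap.smul_comp, map_smul, Complex.coe_smul])
        (fun a b c => by rw [LinearMap.comp_add, map_add])
        (fun r a b => by
          rw [← Complex.coe_smul r b, LinearMap.comp_smul, map_smul, Complex.coe_smul]))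
      α.toMultilinearMap α.toMultilinearMap
    obtain ⟨ζ, hζ⟩ := exists_alternatingMap_eq_wedge (k := 4) (l := n) (LinearMap.mul ℝ ℂ)
      η.toMultilinearMap
      (Complex.ofRealCLM.toLinearMap.compMultilinearMap (Φ x).toAlternatingMap.toMultilinearMap)
    let b : Module.Basis (Fin (4 + n)) ℝ (TangentSpace (𝓡 (4 + n)) x) :=
      (EuclideanSpace.basisFun (Fin (4 + n)) ℝ).toBasis
    obtain ⟨h, hh⟩ := AlternatingMap.exists_eq_mul_of_basis b (o.volForm x)
      ((o.orient x).volumeForm_basis_ne_zero b) ζ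
    refine ⟨h, fun v => (Eq.trans ?_ (hζ v).symm).trans (hh v)⟩
    have h1 : D.traceSq x = η := by
      funext w
      rw [hη w, traceSq, ← hα]
      rfl
    rw [chernForm, h1]
    rfl
  choose h hh using hex
  refine ⟨h, continuous_iff_continuousAt.2 fun x => ?_, hh⟩
  set e := trivializationAt F E x
  have hx : extChartAt (𝓡 (4 + n)) x x ∈ localDomain (4 + n) e x := by
    refine ⟨mem_extChartAt_target x, ?_⟩
    simpa [e] using FiberBundle.mem_baseSet_trivializationAt' x
  -- The coefficient was chosen point by point. In coordinates it is a continuous function divided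
  -- by the density, which is continuous and nowhere zero.
  have h1 : ∀ z ∈ localDomain (4 + n) e x, h ((extChartAt (𝓡 (4 + n)) x).symm z) =
      (4 * (n.factorial : ℂ))⁻¹ * signedSum (fun i => EuclideanSpace.single i (1 : ℝ))
        (chernWeil (endTrace F) (D.localConnForm e x) (formInChart Φ x) z) /
        ((o.chartDensity x z : ℝ) : ℂ) := by
    intro z hz
    rw [← D.chernForm_frame e Φ hz, hh, eq_div_iff]
    · rfl
    · exact_mod_cast o.chartDensity_ne_zero hz.1
  have h2 : ContinuousAt (fun z => (4 * (n.factorial : ℂ))⁻¹ *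
      signedSum (fun i => EuclideanSpace.single i (1 : ℝ))
        (chernWeil (endTrace F) (D.localConnForm e x) (formInChart Φ x) z) /
        ((o.chartDensity x z : ℝ) : ℂ)) (extChartAt (𝓡 (4 + n)) x x) := by
    have hn := (isOpen_localDomain e x).mem_nhds hx
    refine ContinuousAt.div (ContinuousAt.mul continuousAt_const ?_) ?_ ?_
    · refine tendsto_finsetSum _ fun σ _ => ContinuousAt.mul continuousAt_const ?_
      exact (contDiffOn_chernWeil (isOpen_localDomain e x) (D.contDiffOn_localConnForm e x)
        ((hΦ x).mono Set.inter_subset_left) _ _).continuousOn.continuousAt hn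
    · exact Complex.continuous_ofReal.continuousAt.comp
        ((o.continuousOn_chartDensity x).continuousAt
          ((isOpen_extChartAt_target x).mem_nhds hx.1))
    · exact_mod_cast o.chartDensity_ne_zero hx.1
  have h3 := h2.comp (continuousAt_extChartAt (I := 𝓡 (4 + n)) x)
  refine h3.congr ?_
  filter_upwards [(continuousAt_extChartAt (I := 𝓡 (4 + n)) x).preimage_mem_nhds
    ((isOpen_localDomain e x).mem_nhds hx), extChartAt_source_mem_nhds (I := 𝓡 (4 + n)) x]
    with y hy hys
  have h4 := h1 _ hy
  rw [(extChartAt (𝓡 (4 + n)) x).left_inv hys] at h4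
  exact h4.symm

end ComplexConnection

end ChernWeilForm

/-! ### Independence of the connection -/

section Localisation

open MeasureTheory

variable {n : ℕ} {M : Type*} [TopologicalSpace M]
  [ChartedSpace (EuclideanSpace ℝ (Fin (4 + n))) M]
  [IsManifold (𝓡 (4 + n)) ∞ M] [T2Space M]
  {F : Type*} [NormedAddCommGroup F] [NormedSpace ℂ F] [FiniteDimensional ℂ F]
  {E : M → Type*} [TopologicalSpace (TotalSpace F E)]
  [∀ x, NormedAddCommGroup (E x)] [∀ x, InnerProductSpace ℂ (E x)]
  [FiberBundle F E] [VectorBundle ℂ F E] [VectorBundle ℝ F E]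
  [ContMDiffVectorBundle ∞ F E (𝓡 (4 + n))]

namespace ComplexConnection

lemma connForm_congr (D D' : ComplexConnection (4 + n) F E)
    (e : Trivialization F (TotalSpace.proj : TotalSpace F E → M)) [MemTrivializationAtlas e] {x : M}
    (h : ∀ σ, D.toFun σ x = D'.toFun σ x) : D.connForm e x = D'.connForm e x := by
  by_cases hx : x ∈ e.baseSet
  · ext v f
    rw [D.connForm_apply e hx, D'.connForm_apply e hx, h]
  · simp only [connForm, dif_neg hx]

/-- Curvatures of connections which agree near a point agree at this point. -/
lemma curvature_congr (D D' : ComplexConnection (4 + n) F E) {x : M}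
    (h : ∀ᶠ y in 𝓝 x, ∀ σ, D.toFun σ y = D'.toFun σ y) : D.curvature x = D'.curvature x := by
  have hext : ∀ w s, D.curvature x w s = D'.curvature x w s := by
    intro w s
    obtain ⟨a, ha, hσ⟩ := FiberBundle.exists_contMDiffOn_extend (k := ∞) (𝓡 (4 + n)) F s
    have key : ∀ u v : TangentSpace (𝓡 (4 + n)) x,
        D.toFun (fun y => D.toFun (FiberBundle.extend F s) y
          (FiberBundle.extend (EuclideanSpace ℝ (Fin (4 + n))) u y)) x v =
        D'.toFun (fun y => D'.toFun (FiberBundle.extend F s) y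
          (FiberBundle.extend (EuclideanSpace ℝ (Fin (4 + n))) u y)) x v := by
      intro u v
      have hu := FiberBundle.contMDiffAt_extend (k := 1) (𝓡 (4 + n))
        (EuclideanSpace ℝ (Fin (4 + n))) u
      rw [← h.self_of_nhds, D.isCovariantDerivativeOnUniv.congr_of_eventuallyEq
        (D.mdifferentiableAt_apply ha hσ hu) (D'.mdifferentiableAt_apply ha hσ hu) Filter.univ_mem]
      filter_upwards [h] with y hy
      rw [hy]
    change D.curvatureExpr _ _ _ x = D'.curvatureExpr _ _ _ x
    rw [curvatureExpr, curvatureExpr, FiberBundle.extend_apply_self,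
      FiberBundle.extend_apply_self, key, key, h.self_of_nhds]
  funext w
  exact LinearMap.ext (hext w)

lemma chernForm_congr (D D' : ComplexConnection (4 + n) F E)
    (Φ : ∀ x : M, TangentSpace (𝓡 (4 + n)) x [⋀^Fin n]→L[ℝ] ℝ)
    (h : ∀ x σ, D.toFun σ x = D'.toFun σ x) : D.chernForm Φ = D'.chernForm Φ := by
  funext x
  rw [chernForm, chernForm, traceSq, traceSq,
    D.curvature_congr D' (Filter.Eventually.of_forall fun y => h y)]

variable [RiemannianBundle (fun x : M => TangentSpace (𝓡 (4 + n)) x)] [CompactSpace M]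

/-- A change of the connection in a compact subset of a coordinate patch does not change the
integral of `Tr (F_D ∧ F_D) ∧ Φ`. -/
lemma integralForm_chernForm_eq_of_eqOn_compl (o : ManifoldOrientation (4 + n) M)
    {Φ : ∀ x : M, TangentSpace (𝓡 (4 + n)) x [⋀^Fin n]→L[ℝ] ℝ} (hΦ : IsSmoothForm Φ)
    (hdΦ : IsClosedForm Φ) (D D' : ComplexConnection (4 + n) F E)
    (e : Trivialization F (TotalSpace.proj : TotalSpace F E → M)) [MemTrivializationAtlas e]
    (c : M) {K : Set M} (hK : IsCompact K) (hKc : K ⊆ (extChartAt (𝓡 (4 + n)) c).source)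
    (hKe : K ⊆ e.baseSet) (h : ∀ x ∉ K, ∀ σ, D.toFun σ x = D'.toFun σ x) :
    integralForm o (D.chernForm Φ) = integralForm o (D'.chernForm Φ) := by
  obtain ⟨f, hfc, hf⟩ := D.exists_continuous_chernForm_eq o hΦ
  obtain ⟨f', hfc', hf'⟩ := D'.exists_continuous_chernForm_eq o hΦ
  have hform : ∀ x ∉ K, D.chernForm Φ x = D'.chernForm Φ x := by
    intro x hx
    have hcurv := D.curvature_congr D' (x := x) (by
      filter_upwards [hK.isClosed.isOpen_compl.mem_nhds hx] with y hy using h y hy)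
    rw [chernForm, chernForm, traceSq, traceSq, hcurv]
  have hoff : ∀ x ∉ K, (f - f') x = 0 := by
    intro x hx
    let b : Module.Basis (Fin (4 + n)) ℝ (TangentSpace (𝓡 (4 + n)) x) :=
      (EuclideanSpace.basisFun (Fin (4 + n)) ℝ).toBasis
    have hb : ((o.volForm x b : ℝ) : ℂ) ≠ 0 := by
      exact_mod_cast (o.orient x).volumeForm_basis_ne_zero b
    have h1 := hf x b
    rw [hform x hx, hf'] at h1
    rw [Pi.sub_apply, mul_right_cancel₀ hb h1, sub_self]
  have hdiff : ∀ x v, D.chernForm Φ x v - D'.chernForm Φ x v =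
      (f - f') x * ((o.volForm x v : ℝ) : ℂ) := by
    intro x v
    rw [hf, hf', Pi.sub_apply, sub_mul]
  rw [← sub_eq_zero, ← integralForm_sub o hf hfc hf' hfc',
    integralForm_eq_chartIntegral o hdiff (hfc.sub hfc') c hK hKc hoff,
    ManifoldOrientation.chartIntegral]
  set U := localDomain (4 + n) e c
  have hUo : IsOpen U := isOpen_localDomain e c
  -- The absolute density is sign times density, and coefficient times density is the form evaluated
  -- on the frame; the sign and the normalisation 1/(4 n!) remain as the weight.
  set s : EuclideanSpace ℝ (Fin (4 + n)) → ℂ := fun z =>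
    (4 * (n.factorial : ℂ))⁻¹ * (((SignType.sign (o.chartDensity c z) : ℝ)) : ℂ) with hs
  rw [setIntegral_eq_of_subset_of_forall_sdiff_eq_zero (s := U)
    (isOpen_extChartAt_target c).measurableSet Set.inter_subset_left fun z hz => by
      rw [hoff, zero_mul]
      exact fun hzK => hz.2 ⟨hz.1, hKe hzK⟩]
  have hKi : IsCompact (extChartAt (𝓡 (4 + n)) c '' K) :=
    hK.image_of_continuousOn ((continuousOn_extChartAt c).mono hKc)
  have hKU : extChartAt (𝓡 (4 + n)) c '' K ⊆ U := by
    rintro _ ⟨x, hx, rfl⟩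
    refine ⟨(extChartAt (𝓡 (4 + n)) c).map_source (hKc hx), ?_⟩
    rw [Set.mem_preimage, (extChartAt (𝓡 (4 + n)) c).left_inv (hKc hx)]
    exact hKe hx
  rw [← setIntegral_signedSum_chernWeil_sub_eq_zero (μ := volume) endTrace_mul_comm hUo hKi hKU
    (D.contDiffOn_localConnForm e c) (D'.contDiffOn_localConnForm e c) ?_
    ((hΦ c).mono Set.inter_subset_left) (fun z hz => hdΦ c z hz.1) (s := s) ?_
    (fun i => EuclideanSpace.single i (1 : ℝ))]
  · refine setIntegral_congr_fun hUo.measurableSet fun z hz => ?_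
    have h2 : |o.chartDensity c z| = (SignType.sign (o.chartDensity c z) : ℝ) *
      o.chartDensity c z := (sign_mul_self _).symm
    have h3 := hdiff _ (coordFrame c z)
    rw [D.chernForm_frame e Φ hz, D'.chernForm_frame e Φ hz, ← mul_sub] at h3
    rw [h2, Complex.ofReal_mul, mul_left_comm]
    refine (congrArg (fun t => (((SignType.sign (o.chartDensity c z) : ℝ)) : ℂ) * t)
      h3.symm).trans ?_
    simp only [hs]
    ring
  · intro z hz hzK
    have hx : (extChartAt (𝓡 (4 + n)) c).symm z ∉ K := fun hx =>
      hzK ⟨_, hx, (extChartAt (𝓡 (4 + n)) c).right_inv hz.1⟩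
    rw [localConnForm, localConnForm, D.connForm_congr D' e (h _ hx)]
  -- The sign is locally constant because the density is continuous and nonvanishing.
  · intro z hz
    have hc := (o.continuousOn_chartDensity c).continuousAt
      ((isOpen_extChartAt_target c).mem_nhds hz.1)
    rcases lt_or_gt_of_ne (o.chartDensity_ne_zero hz.1) with h0 | h0
    · filter_upwards [hc.eventually_lt continuousAt_const h0] with y hy
      simp only [hs, sign_neg hy, sign_neg h0]
    · filter_upwards [continuousAt_const.eventually_lt hc h0] with y hy
      simp only [hs, sign_pos hy, sign_pos h0]

/-- The affine combination `D + g (A - D)` of two connections. -/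
def interpolate (D A : ComplexConnection (4 + n) F E) (g : M → ℝ)
    (hg : ContMDiff (𝓡 (4 + n)) 𝓘(ℝ, ℝ) ∞ g) : ComplexConnection (4 + n) F E where
  toFun := fun σ => g • A.toFun σ + (1 - g) • D.toFun σ
  isCovariantDerivativeOnUniv :=
    A.isCovariantDerivativeOnUniv.affine_combination D.isCovariantDerivativeOnUniv g
  smooth := ContMDiffCovariantDerivativeOn.affine_combination hg.contMDiffOn A.smooth D.smooth
  smul_section a {σ x} hσ v := by
    change g x • A.toFun _ x v + (1 - g x) • D.toFun _ x v =
      a • (g x • A.toFun σ x v + (1 - g x) • D.toFun σ x v)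
    rw [A.smul_section a hσ, D.smul_section a hσ, smul_add, smul_comm a (g x),
      smul_comm a (1 - g x)]

lemma interpolate_apply (D A : ComplexConnection (4 + n) F E) (g : M → ℝ)
    (hg : ContMDiff (𝓡 (4 + n)) 𝓘(ℝ, ℝ) ∞ g) (σ : ∀ x, E x) (x : M) :
    (interpolate D A g hg).toFun σ x = g x • A.toFun σ x + (1 - g x) • D.toFun σ x := rfl

/-- The integral of `Tr (F_D ∧ F_D) ∧ Φ` does not depend on the connection. -/
theorem integralForm_chernForm_eq (o : ManifoldOrientation (4 + n) M)
    {Φ : ∀ x : M, TangentSpace (𝓡 (4 + n)) x [⋀^Fin n]→L[ℝ] ℝ} (hΦ : IsSmoothForm Φ)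
    (hdΦ : IsClosedForm Φ) (D A : ComplexConnection (4 + n) F E) :
    integralForm o (A.chernForm Φ) = integralForm o (D.chernForm Φ) := by
  classical
  obtain ⟨ψ, hψ⟩ := SmoothPartitionOfUnity.exists_isSubordinate (𝓡 (4 + n)) isClosed_univ
    (fun c : M => (extChartAt (𝓡 (4 + n)) c).source ∩ (trivializationAt F E c).baseSet)
    (fun c => (isOpen_extChartAt_source c).inter (trivializationAt F E c).open_baseSet)
    (fun x _ => Set.mem_iUnion.2 ⟨x, mem_extChartAt_source x,
      FiberBundle.mem_baseSet_trivializationAt' x⟩)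
  have hfin : {c : M | ∃ x, ψ c x ≠ 0}.Finite := ψ.locallyFinite.finite_nonempty_of_compact
  have hsmooth : ∀ S : Finset M,
      ContMDiff (𝓡 (4 + n)) 𝓘(ℝ, ℝ) ∞ (fun x => ∑ c ∈ S, ψ c x) := fun S =>
    contMDiff_finsetSum fun c _ => (ψ c).contMDiff
  -- The empty set gives `D`, and the full set of indices gives `A`. Adding an index `c` alters the
  -- connection only on the support of `ψ c`, a compact subset of one patch.
  have hind : ∀ S : Finset M, integralForm o ((interpolate D A _ (hsmooth S)).chernForm Φ) =
      integralForm o (D.chernForm Φ) := by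
    intro S
    induction S using Finset.induction_on with
    | empty =>
      rw [chernForm_congr (interpolate D A _ (hsmooth ∅)) D Φ fun x σ => ?_]
      rw [interpolate_apply, Finset.sum_empty, zero_smul, sub_zero, one_smul, zero_add]
    | insert c S hc ih =>
      rw [← ih]
      refine integralForm_chernForm_eq_of_eqOn_compl o hΦ hdΦ _ _ (trivializationAt F E c) c
        (isClosed_tsupport (ψ c)).isCompact ((hψ c).trans Set.inter_subset_left)
        ((hψ c).trans Set.inter_subset_right) fun x hx σ => ?_
      rw [interpolate_apply, interpolate_apply, Finset.sum_insert hc,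
        image_eq_zero_of_notMem_tsupport hx, zero_add]
  rw [← hind hfin.toFinset]
  rw [chernForm_congr A _ Φ fun x σ => ?_]
  have hone : ∑ c ∈ hfin.toFinset, ψ c x = 1 := by
    rw [← ψ.sum_eq_one (Set.mem_univ x), finsum_eq_sum_of_support_subset]
    intro c hc
    simpa using ⟨x, hc⟩
  rw [interpolate_apply, hone, one_smul, sub_self, zero_smul, add_zero]

end ComplexConnection

end Localisation

/-! ### Sign and equality for calibrated connections -/

section Calibrated

lemma integralForm_const_mul {m : ℕ} {M : Type*} [TopologicalSpace M]
    [ChartedSpace (EuclideanSpace ℝ (Fin m)) M] [IsManifold (𝓡 m) ∞ M] [T2Space M] [CompactSpace M]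
    [RiemannianBundle (fun x : M => TangentSpace (𝓡 m) x)] (o : ManifoldOrientation m M)
    {η : ∀ x : M, (Fin m → TangentSpace (𝓡 m) x) → ℂ} {h : M → ℂ}
    (hη : ∀ x v, η x v = h x * ((o.volForm x v : ℝ) : ℂ)) (a : ℂ) :
    integralForm o (fun x v => a * η x v) = a * integralForm o η := by
  rw [integralForm_eq_sum o hη, integralForm_eq_sum o (h := fun x => a * h x)
    (fun x v => by rw [hη, mul_assoc]), Finset.mul_sum]
  refine Finset.sum_congr rfl fun c _ => ?_
  simp only [ManifoldOrientation.chartIntegral]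
  rw [← MeasureTheory.integral_const_mul]
  congr 1
  funext z
  ring

lemma hsNormSq_nonneg {V : Type*} [NormedAddCommGroup V] [InnerProductSpace ℂ V]
    [FiniteDimensional ℂ V] (a : V →ₗ[ℂ] V) : 0 ≤ hsNormSq a :=
  Finset.sum_nonneg fun _ _ => sq_nonneg _

lemma eq_zero_of_hsNormSq_eq_zero {V : Type*} [NormedAddCommGroup V] [InnerProductSpace ℂ V]
    [FiniteDimensional ℂ V] {a : V →ₗ[ℂ] V} (h : hsNormSq a = 0) : a = 0 := by
  refine (stdOrthonormalBasis ℂ V).toBasis.ext fun k => ?_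
  have := (Finset.sum_eq_zero_iff_of_nonneg fun _ _ => sq_nonneg _).1 h k (Finset.mem_univ k)
  simpa using this

variable {n : ℕ} {M : Type*} [TopologicalSpace M]
  [ChartedSpace (EuclideanSpace ℝ (Fin (4 + n))) M]
  [IsManifold (𝓡 (4 + n)) ∞ M] [T2Space M]
  {F : Type*} [NormedAddCommGroup F] [NormedSpace ℂ F] [FiniteDimensional ℂ F]
  {E : M → Type*} [TopologicalSpace (TotalSpace F E)]
  [∀ x, NormedAddCommGroup (E x)] [∀ x, InnerProductSpace ℂ (E x)]
  [FiberBundle F E] [VectorBundle ℂ F E] [VectorBundle ℝ F E]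
  [ContMDiffVectorBundle ∞ F E (𝓡 (4 + n))]
  [RiemannianBundle (fun x : M => TangentSpace (𝓡 (4 + n)) x)]

namespace ComplexConnection

lemma curvatureNormSq_nonneg (D : ComplexConnection (4 + n) F E) (x : M) :
    0 ≤ D.curvatureNormSq x :=
  Finset.sum_nonneg fun _ _ => Finset.sum_nonneg fun _ _ =>
    @hsNormSq_nonneg _ _ _ (finiteDimensional_fiber F x) _

/-- The norm controls only the components with i < j; the others follow because the curvature is
alternating, and an alternating map is determined by its values on basis vectors. -/
lemma curvature_eq_zero_of_curvatureNormSq_eq_zero (D : ComplexConnection (4 + n) F E) {x : M}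
    (h : D.curvatureNormSq x = 0) (w : Fin 2 → TangentSpace (𝓡 (4 + n)) x) :
    D.curvature x w = 0 := by
  have : FiniteDimensional ℂ (E x) := finiteDimensional_fiber F x
  set e := stdOrthonormalBasis ℝ (TangentSpace (𝓡 (4 + n)) x)
  have h1 : ∀ i j, i < j → D.curvature x ![e i, e j] = 0 := by
    intro i j hij
    have h2 := (Finset.sum_eq_zero_iff_of_nonneg fun i _ => Finset.sum_nonneg fun j _ =>
      hsNormSq_nonneg _).1 h i (Finset.mem_univ i)
    have h3 := (Finset.sum_eq_zero_iff_of_nonneg fun j _ =>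
      hsNormSq_nonneg _).1 h2 j (Finset.mem_Ioi.2 hij)
    exact eq_zero_of_hsNormSq_eq_zero h3
  obtain ⟨α, hα⟩ := D.exists_alternatingMap_eq_curvature x
  rw [← hα] at h1 ⊢
  have h0 : α = 0 := by
    refine Module.Basis.ext_alternating e.toBasis fun v hv => ?_
    have hv01 : v 0 ≠ v 1 := fun h => absurd (hv h) (by simp)
    have hvec : (fun i => e.toBasis (v i)) = ![e (v 0), e (v 1)] := by
      funext i
      fin_cases i <;> simp
    rw [hvec, AlternatingMap.zero_apply]
    rcases lt_or_gt_of_ne hv01 with hlt | hgt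
    · exact h1 _ _ hlt
    · have hswap := α.map_swap ![e (v 1), e (v 0)] (i := 0) (j := 1) (by simp)
      have hvec' : ![e (v 1), e (v 0)] ∘ Equiv.swap (0 : Fin 2) 1 = ![e (v 0), e (v 1)] := by
        funext i
        fin_cases i <;> simp
      rw [hvec', h1 _ _ hgt, neg_zero] at hswap
      exact hswap
  rw [h0, AlternatingMap.zero_apply]

variable [CompactSpace M]

/-- The negative constant, coming from i² = -1, is what turns the nonnegative integral of a
calibrated connection into the upper bound 0. -/
lemma chernNumber_eq (D : ComplexConnection (4 + n) F E) (o : ManifoldOrientation (4 + n) M)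
    {Φ : ∀ x : M, TangentSpace (𝓡 (4 + n)) x [⋀^Fin n]→L[ℝ] ℝ} (hΦ : IsSmoothForm Φ) :
    D.chernNumber o Φ = ((-(1 / (8 * Real.pi ^ 2)) : ℝ) : ℂ) * integralForm o (D.chernForm Φ) := by
  obtain ⟨h, -, hh⟩ := D.exists_continuous_chernForm_eq o hΦ
  have hconst : (1 / 2 : ℂ) * (Complex.I / (2 * Real.pi)) ^ 2 =
      ((-(1 / (8 * Real.pi ^ 2)) : ℝ) : ℂ) := by
    rw [div_pow, Complex.I_sq]
    push_cast
    ring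
  rw [← integralForm_const_mul o hh, ← hconst, chernNumber]
  congr 1
  funext x v
  exact wedge_mul_left _ _ _ v

lemma chernNumber_eq_zero_of_isFlat (D : ComplexConnection (4 + n) F E)
    (o : ManifoldOrientation (4 + n) M)
    {Φ : ∀ x : M, TangentSpace (𝓡 (4 + n)) x [⋀^Fin n]→L[ℝ] ℝ} (hΦ : IsSmoothForm Φ)
    (hD : D.IsFlat) : D.chernNumber o Φ = 0 := by
  have h : ∀ x v, D.chernForm Φ x v = 0 * ((o.volForm x v : ℝ) : ℂ) := by
    intro x v
    have hc : D.curvature x = fun _ => 0 := funext (hD x)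
    simp [chernForm, traceSq, wedge, hc]
  rw [D.chernNumber_eq o hΦ, integralForm_eq_sum o (h := fun _ => 0) h]
  simp [ManifoldOrientation.chartIntegral]

/-- The integral of `Tr (F_D ∧ F_D) ∧ Φ` for a calibrated connection. -/
lemma IsCalibrated.exists_integralForm_eq {D : ComplexConnection (4 + n) F E}
    {o : ManifoldOrientation (4 + n) M}
    {Φ : ∀ x : M, TangentSpace (𝓡 (4 + n)) x [⋀^Fin n]→L[ℝ] ℝ} (hΦ : IsSmoothForm Φ)
    (hD : D.IsCalibrated o Φ) :
    ∃ r : ℝ, integralForm o (D.chernForm Φ) = (r : ℂ) ∧ 0 ≤ r ∧ (r = 0 → D.IsFlat) := by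
  obtain ⟨h, hc, hh⟩ := D.exists_continuous_chernForm_eq o hΦ
  have heq : ∀ x, h x = ((D.curvatureNormSq x : ℝ) : ℂ) := by
    intro x
    let b : Module.Basis (Fin (4 + n)) ℝ (TangentSpace (𝓡 (4 + n)) x) :=
      (EuclideanSpace.basisFun (Fin (4 + n)) ℝ).toBasis
    have hb : ((o.volForm x b : ℝ) : ℂ) ≠ 0 := by
      exact_mod_cast (o.orient x).volumeForm_basis_ne_zero b
    have h1 := (hh x b).symm.trans (hD.2 x b)
    rw [Complex.ofReal_mul] at h1
    exact mul_right_cancel₀ hb h1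
  -- Continuity of |F_D|² is read off from the calibration identity, which equates it with the
  -- continuous coefficient `h`; no continuous choice of orthonormal frames is needed.
  have hcont : Continuous D.curvatureNormSq := by
    have : D.curvatureNormSq = fun x => (h x).re := by
      funext x
      rw [heq, Complex.ofReal_re]
    rw [this]
    exact Complex.continuous_re.comp hc
  obtain ⟨r, hr, hr0, hz⟩ := exists_integralForm_eq_ofReal o (η := D.chernForm Φ) hD.2 hcont
    D.curvatureNormSq_nonneg
  exact ⟨r, hr, hr0, fun h0 x w => D.curvature_eq_zero_of_curvatureNormSq_eq_zero (hz h0 x) w⟩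

end ComplexConnection

end Calibrated

end

theorem mainTheorem8
    -- a compact oriented Riemannian manifold `M` without boundary, of dimension `4 + n`
    {n : ℕ} {M : Type*} [TopologicalSpace M] [T2Space M] [CompactSpace M]
    [ChartedSpace (EuclideanSpace ℝ (Fin (4 + n))) M] [IsManifold (𝓡 (4 + n)) ∞ M]
    [RiemannianBundle (fun x : M => TangentSpace (𝓡 (4 + n)) x)]
    [IsContMDiffRiemannianBundle (𝓡 (4 + n)) ∞ (EuclideanSpace ℝ (Fin (4 + n)))
      (fun x : M => TangentSpace (𝓡 (4 + n)) x)]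
    (o : ManifoldOrientation (4 + n) M)
    -- a smooth Hermitian vector bundle `E` over `M`, with typical fibre `F`
    {F : Type*} [NormedAddCommGroup F] [NormedSpace ℂ F] [FiniteDimensional ℂ F]
    {E : M → Type*} [TopologicalSpace (TotalSpace F E)]
    [∀ x, NormedAddCommGroup (E x)] [∀ x, InnerProductSpace ℂ (E x)]
    [FiberBundle F E] [VectorBundle ℂ F E] [VectorBundle ℝ F E]
    [ContMDiffVectorBundle ∞ F E (𝓡 (4 + n))] [IsSmoothHermitianBundle (4 + n) F E]
    -- a smooth closed form `Φ` of degree `n = dim M - 4` and a connection calibrated by it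
    (Φ : ∀ x : M, TangentSpace (𝓡 (4 + n)) x [⋀^Fin n]→L[ℝ] ℝ)
    (hΦ : IsSmoothForm Φ) (hdΦ : IsClosedForm Φ)
    (D : ComplexConnection (4 + n) F E) (hD : D.IsCalibrated o Φ)
    -- `ch(E)` may be computed by any connection on `E`
    (A : ComplexConnection (4 + n) F E) :
    (A.chernNumber o Φ).im = 0 ∧ (A.chernNumber o Φ).re ≤ 0 ∧
      (A.chernNumber o Φ = 0 ↔ IsFlatBundle (4 + n) F E) ∧
      (A.chernNumber o Φ = 0 ↔ D.IsFlat) := by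
  have hconj := A.chernNumber_eq o hΦ
  rw [ComplexConnection.integralForm_chernForm_eq o hΦ hdΦ D A] at hconj
  obtain ⟨r, hr, hr0, hflat⟩ := hD.exists_integralForm_eq hΦ
  rw [hr, ← Complex.ofReal_mul] at hconj
  have hpos : 0 < 1 / (8 * Real.pi ^ 2) := by positivity
  have hzero : A.chernNumber o Φ = 0 → D.IsFlat := by
    intro h
    rw [hconj, Complex.ofReal_eq_zero, mul_eq_zero, neg_eq_zero] at h
    exact hflat (h.resolve_left hpos.ne')
  -- Any flat connection may be used to compute the number, so the same argument serves for flatness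
  -- of the bundle and of `D`.
  have hback : ∀ D' : ComplexConnection (4 + n) F E, D'.IsFlat → A.chernNumber o Φ = 0 := by
    intro D' hD'
    rw [A.chernNumber_eq o hΦ, ComplexConnection.integralForm_chernForm_eq o hΦ hdΦ D' A,
      ← D'.chernNumber_eq o hΦ, D'.chernNumber_eq_zero_of_isFlat o hΦ hD']
  refine ⟨?_, ?_, ⟨fun h => ⟨D, hD.1, hzero h⟩, ?_⟩, hzero, hback D⟩
  · rw [hconj, Complex.ofReal_im]
  · rw [hconj, Complex.ofReal_re]
    exact mul_nonpos_of_nonpos_of_nonneg (neg_nonpos.2 hpos.le) hr0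
  · rintro ⟨D', -, hD'⟩
    exact hback D' hD'
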